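/- Let $\gamma:[0,\infty)\times\mathbb R/\mathbb Z\to\mathbb R^2$ be a family of closed immersed plane curves ($\partial_u\gamma\neq0$), with $\gamma,\partial_u\gamma,\partial_u^2\gamma$ continuous for $t\ge 0$ and $\partial_t\gamma$ continuous for $t>0$. For each $t$ let $s$ be the arc length, $L=L(t)$ the total length, $\tau=\partial_s\gamma$ the unit tangent, $\nu$ the rotation of $\tau$ counter-clockwise by $\pi/2$, $\kappa=\partial_s^2\gamma\cdot\nu$ the curvature, $\tilde\kappa=\kappa-\frac1L\int_0^L\kappa\,ds$ and $A=-\frac12\int_0^L\gamma\cdot\nu\,ds$. Let $n=\frac1{2\pi}\int_0^L\kappa\,ds$ be the rotation number (it does not depend on $t$) and set $$I_{-1}(t)=1-\frac{4n\pi A(t)}{L(t)^2}.$$ Suppose that $\gamma$ is a global classical solution of $$\partial_t\gamma\cdot\nu=\tilde\kappa-\frac gL\qquad(t>0)$$ (as is the case in particular if $\partial_t\gamma=(\tilde\kappa-\frac gL)\nu$), where $g$ is one of - (AP) $g=0$ (area-preserving flow); - (LP) $g=L\left(\int_0^L\kappa\,ds\right)^{-1}\int_0^L\tilde\kappa^2\,ds$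 (length-preserving flow); - (JP) $g=\frac{L^2}{2A}-\int_0^L\kappa\,ds$ (the flow of Jiang and Pan). Suppose that $n\ge1$ and $A(0)>0$. Then for all $t\ge0$ $$0\le I_{-1}(t)\le\frac{L(0)^2I_{-1}(0)}{L(t)^2}\exp\left(-\int_0^t\frac{8\pi^2n}{L(\tau)^2}\,d\tau\right).$$ In particular, for all $t\ge0$: in the case (AP), $$0\le I_{-1}(t)\le\frac{L(0)^2I_{-1}(0)}{4\pi nA(0)}\exp\left(-\frac{8\pi^2n}{L(0)^2}t\right);$$ in the case (LP), $$0\le I_{-1}(t)\le I_{-1}(0)\exp\left(-\frac{8\pi^2n}{L(0)^2}t\right);$$ and in the case (JP), $\bar L=\sup_{t\in[0,\infty)}L(t)$ is finite and $$0\le I_{-1}(t)\le\frac{L(0)^2I_{-1}(0)}{4\pi nA(0)}\exp\left(-\frac{8\pi^2n}{\bar L^2}t\right).$$ -/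

import Mathlib

noncomputable section

namespace CurveFlow

/-! Closed plane curves are maps `c : ℝ → ℂ` of period `1`, with `ℝ²` identified with `ℂ`; the
parameter is arbitrary and `ds = ‖c'(u)‖ du` is the arc-length element. The rotation by `π / 2`
counter-clockwise is multiplication by `Complex.I`, and `inner ℝ` is the Euclidean inner product. -/

/-- The line integral `∫ φ ds` over one period of the curve. -/
def arcIntegral (c : ℝ → ℂ) (φ : ℝ → ℝ) : ℝ :=
  ∫ u in (0 : ℝ)..1, φ u * ‖deriv c u‖

/-- The total length `L`. -/
def length (c : ℝ → ℂ) : ℝ :=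
  arcIntegral c (fun _ => 1)

/-- The unit tangent vector `τ = ∂ₛ c`. -/
def tangent (c : ℝ → ℂ) (u : ℝ) : ℂ :=
  ‖deriv c u‖⁻¹ • deriv c u

/-- The unit normal vector `ν`, the counter-clockwise rotation of `τ` by `π / 2`. -/
def normal (c : ℝ → ℂ) (u : ℝ) : ℂ :=
  Complex.I * tangent c u

/-- The curvature vector `∂ₛ² c = ∂ₛ τ`. -/
def curvatureVector (c : ℝ → ℂ) (u : ℝ) : ℂ :=
  ‖deriv c u‖⁻¹ • deriv (tangent c) u

/-- The signed curvature `κ`. -/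
def curvature (c : ℝ → ℂ) (u : ℝ) : ℝ :=
  inner ℝ (curvatureVector c u) (normal c u)

/-- The total curvature `∫ κ ds`. -/
def totalCurvature (c : ℝ → ℂ) : ℝ :=
  arcIntegral c (curvature c)

/-- The rotation number `(1 / 2π) ∫ κ ds`. -/
def rotationNumber (c : ℝ → ℂ) : ℝ :=
  1 / (2 * Real.pi) * totalCurvature c

/-- The deviation of the curvature from its mean, `κ - (1 / L) ∫ κ ds`. -/
def curvatureDeviation (c : ℝ → ℂ) (u : ℝ) : ℝ :=
  curvature c u - 1 / length c * totalCurvature c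

/-- The signed (algebraic) area `A = -(1 / 2) ∫ c · ν ds`. -/
def area (c : ℝ → ℂ) : ℝ :=
  -(1 / 2) * arcIntegral c (fun u => inner ℝ (c u) (normal c u))

/-- The isoperimetric deficit `1 - 4 n π A / L²`, where `n` is the rotation number. -/
def deficit (c : ℝ → ℂ) : ℝ :=
  1 - 4 * rotationNumber c * Real.pi * area c / length c ^ 2

/-- The three flows: area-preserving, length-preserving, and the flow of Jiang and Pan. -/
inductive FlowKind
  | AP
  | LP
  | JP

/-- The non-local term `g`. -/
def nonlocalTerm : FlowKind → (ℝ → ℂ) → ℝ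
  | .AP, _ => 0
  | .LP, c => length c * (totalCurvature c)⁻¹ * arcIntegral c (fun u => curvatureDeviation c u ^ 2)
  | .JP, c => length c ^ 2 / (2 * area c) - totalCurvature c

/-- `γ t u` (time `t`, curve parameter `u`) is a classical solution, on the time interval `[0, ∞)`,
of the flow of closed immersed plane curves with normal velocity `κ - (1 / L) ∫ κ ds - g / L`.
Classical means: `γ`, `∂ᵤ γ`, `∂ᵤ² γ` exist and are continuous for `t ≥ 0`, `∂ₜ γ` exists and is
continuous for `t > 0`. Only the normal component of `∂ₜ γ` is prescribed, so that the curves may be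
parametrized arbitrarily (proportionally to arc length, or such that `∂ₜ γ` is normal). -/
structure IsGlobalClassicalSolution (F : FlowKind) (γ : ℝ → ℝ → ℂ) : Prop where
  periodic : ∀ t, 0 ≤ t → Function.Periodic (γ t) 1
  contDiff : ∀ t, 0 ≤ t → ContDiff ℝ 2 (γ t)
  immersed : ∀ t, 0 ≤ t → ∀ u, deriv (γ t) u ≠ 0
  continuousOn : ContinuousOn (fun p : ℝ × ℝ => γ p.1 p.2) (Set.Ici 0 ×ˢ Set.univ)
  continuousOn_deriv :
    ContinuousOn (fun p : ℝ × ℝ => deriv (γ p.1) p.2) (Set.Ici 0 ×ˢ Set.univ)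
  continuousOn_deriv_deriv :
    ContinuousOn (fun p : ℝ × ℝ => deriv (deriv (γ p.1)) p.2) (Set.Ici 0 ×ˢ Set.univ)
  differentiableAt_time : ∀ t, 0 < t → ∀ u, DifferentiableAt ℝ (fun r => γ r u) t
  continuousOn_deriv_time :
    ContinuousOn (fun p : ℝ × ℝ => deriv (fun r => γ r p.2) p.1) (Set.Ioi 0 ×ˢ Set.univ)
  equation : ∀ t, 0 < t → ∀ u,
    inner ℝ (deriv (fun r => γ r u) t) (normal (γ t) u) =
      curvatureDeviation (γ t) u - nonlocalTerm F (γ t) / length (γ t)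

end CurveFlow

end

open CurveFlow

/-! Everything rests on the gap `D = L² - 4πnA`, which equals `L²` times the deficit. The first
variation formulas give `L' = -∫κ̃² ds + 2πn g/L` and `A' = g`, so the non-local term cancels and
`D' = -2L ∫κ̃² ds` for all three flows.

The dissipation is compared with `D` by Fourier series in arc length. With `ω = 2πn/L`, the mean
curvature, the vector `κ̃ν` is `z'' - iωz'` for the position `z`, a multiplier with symbol `-(2π/L)²
k(k-n)`, and `-∫⟨z, κ̃ν⟩ ds = D/L`. If `d m ≤ m²` for every `m = k(k-n)`, then `D' ≤ -(8π²d/L²) D`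
(`wirtinger_second_order`, `deriv_isoperimetricGap_le`). Taking `d = n` and applying Grönwall gives
the decay.

For `n > 1` the sign of `D` is not a property of a single curve; it comes from global existence. The
choice `d = -1` makes a negative gap decrease at a definite rate while `L` is bounded, which
contradicts a lower bound on `D` in the cases AP and LP. For JP, `(A²)' = D` while `A > 0`; thus a
negative gap would make `A²` negative in finite time.

Since `∂ₜ∂ᵤγ` is not assumed to exist, `L` and `A` are differentiated through exact increment
formulas in which the parameter derivative has been integrated by parts off `γ r - γ t`. -/

/-! ### Fourier series and the Wirtinger inequality -/

open MeasureTheory Complex in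
theorem fourierCoeffOn_deriv_of_periodic {T : ℝ} (hT : 0 < T) {f f' : ℝ → ℂ}
    (hf : ∀ x, HasDerivAt f (f' x) x) (hf' : Continuous f') (hper : f T = f 0) (k : ℤ) :
    fourierCoeffOn hT f' k = (2 * Real.pi * k / T : ℝ) * I * fourierCoeffOn hT f k := by
  have hint : IntervalIntegrable f' volume 0 T := hf'.intervalIntegrable _ _
  have hTC : (T : ℂ) ≠ 0 := by exact_mod_cast hT.ne'
  by_cases hk : k = 0
  · subst hk
    rw [fourierCoeffOn_eq_integral]
    have := intervalIntegral.integral_eq_sub_of_hasDerivAt (fun x _ => hf x) hint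
    simp [this, hper]
  · have hkC : (k : ℂ) ≠ 0 := by exact_mod_cast hk
    rw [fourierCoeffOn_of_hasDerivAt hT hk (fun x _ => hf x) hint, hper]
    have hpi : (Real.pi : ℂ) ≠ 0 := by exact_mod_cast Real.pi_ne_zero
    push_cast
    field_simp
    simp

open MeasureTheory in
theorem fourierCoeffOn_add_of_continuous {T : ℝ} (hT : 0 < T) {f g : ℝ → ℂ}
    (hf : Continuous f) (hg : Continuous g) (k : ℤ) :
    fourierCoeffOn hT (fun x => f x + g x) k = fourierCoeffOn hT f k + fourierCoeffOn hT g k := by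
  have hF : ∀ h : ℝ → ℂ, Continuous h → IntervalIntegrable
      (fun x : ℝ => fourier (-k) (x : AddCircle (T - 0)) • h x) volume 0 T := fun h hh =>
    (((fourier (-k)).continuous.comp (AddCircle.continuous_mk' _)).smul hh).intervalIntegrable _ _
  simp only [fourierCoeffOn_eq_integral, smul_add]
  rw [intervalIntegral.integral_add (hF f hf) (hF g hg), smul_add]

open MeasureTheory in
theorem hasSum_sq_fourierCoeffOn_of_continuous {T : ℝ} (hT : 0 < T) {f : ℝ → ℂ}
    (hf : Continuous f) :
    HasSum (fun k => ‖fourierCoeffOn hT f k‖ ^ 2) (T⁻¹ * ∫ x in (0 : ℝ)..T, ‖f x‖ ^ 2) := by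
  have hL : MemLp f 2 (volume.restrict (Set.Ioc 0 T)) := by
    obtain ⟨C, hC⟩ := isCompact_Icc.exists_bound_of_continuousOn (hf.continuousOn (s := Set.Icc 0 T))
    exact MemLp.of_bound hf.aestronglyMeasurable C <|
      (ae_restrict_mem measurableSet_Ioc).mono fun x hx => hC x (Set.Ioc_subset_Icc_self hx)
  simpa using hasSum_sq_fourierCoeffOn hT hL

open MeasureTheory in
/-- If `p` is the image of the periodic function `z` under a Fourier multiplier whose symbol is
`-m`, and `d m ≤ m²`, then `∫ ‖p‖² ≥ -d ∫ ⟪z, p⟫`. -/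
theorem integral_norm_sq_ge_of_fourierCoeffOn {T : ℝ} (hT : 0 < T) {z p : ℝ → ℂ}
    (hz : Continuous z) (hp : Continuous p) (m : ℤ → ℝ) (d : ℝ)
    (hc : ∀ k, fourierCoeffOn hT p k = (-m k : ℝ) * fourierCoeffOn hT z k)
    (hm : ∀ k, d * m k ≤ m k ^ 2) :
    -(d * ∫ x in (0 : ℝ)..T, inner ℝ (z x) (p x)) ≤ ∫ x in (0 : ℝ)..T, ‖p x‖ ^ 2 := by
  -- Completing the square: `‖p + q‖² - ‖q‖² = ‖p‖² + d⟪z, p⟫`, while on coefficients `(-m + d/2)² ≥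
  -- (d/2)²` is exactly `d m ≤ m²`. Parseval for `q` and `p + q` therefore suffices, without a
  -- polarized version.
  set q : ℝ → ℂ := fun x => ((d / 2 : ℝ) : ℂ) * z x with hq
  have hqc : Continuous q := by fun_prop
  have h1 := hasSum_sq_fourierCoeffOn_of_continuous hT hqc
  have h2 := hasSum_sq_fourierCoeffOn_of_continuous hT (hp.add hqc)
  have hle : T⁻¹ * ∫ x in (0 : ℝ)..T, ‖q x‖ ^ 2 ≤
      T⁻¹ * ∫ x in (0 : ℝ)..T, ‖p x + q x‖ ^ 2 := by
    refine hasSum_le (fun k => ?_) h1 h2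
    have e1 : fourierCoeffOn hT q k = ((d / 2 : ℝ) : ℂ) * fourierCoeffOn hT z k :=
      fourierCoeffOn.const_mul _ _ _ _
    have e2 : fourierCoeffOn hT (p + q) k =
        ((-m k + d / 2 : ℝ) : ℂ) * fourierCoeffOn hT z k := by
      have := fourierCoeffOn_add_of_continuous hT hp hqc k
      rw [e1, hc] at this
      rw [show p + q = fun x => p x + q x from rfl, this]
      push_cast
      ring
    rw [e1, e2, norm_mul, norm_mul, mul_pow, mul_pow, Complex.norm_real, Complex.norm_real,
      Real.norm_eq_abs, Real.norm_eq_abs, sq_abs, sq_abs]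
    refine mul_le_mul_of_nonneg_right ?_ (sq_nonneg _)
    nlinarith [hm k]
  have hle' := le_of_mul_le_mul_left hle (inv_pos.2 hT)
  have hex : ∀ x, ‖p x + q x‖ ^ 2 = ‖p x‖ ^ 2 + d * inner ℝ (z x) (p x) + ‖q x‖ ^ 2 := by
    intro x
    have : inner ℝ (p x) (q x) = d / 2 * inner ℝ (z x) (p x) := by
      rw [hq, real_inner_comm, ← real_inner_smul_left]
      simp
    rw [norm_add_sq_real, this]
    ring
  simp only [hex] at hle'
  have i1 : IntervalIntegrable (fun x => ‖p x‖ ^ 2) volume 0 T :=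
    (by fun_prop : Continuous fun x => ‖p x‖ ^ 2).intervalIntegrable _ _
  have i2 : IntervalIntegrable (fun x => d * inner ℝ (z x) (p x)) volume 0 T :=
    (by fun_prop : Continuous fun x => d * inner ℝ (z x) (p x)).intervalIntegrable _ _
  have i3 : IntervalIntegrable (fun x => ‖q x‖ ^ 2) volume 0 T :=
    (by fun_prop : Continuous fun x => ‖q x‖ ^ 2).intervalIntegrable _ _
  rw [intervalIntegral.integral_add (i1.add i2) i3, intervalIntegral.integral_add i1 i2,
    intervalIntegral.integral_const_mul] at hle'
  linarith

open Complex in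
/-- A Wirtinger type inequality for the operator `z ↦ z'' - (2 π N / T) i z'`. -/
theorem wirtinger_second_order {T : ℝ} (hT : 0 < T) {z z1 z2 : ℝ → ℂ}
    (hz : ∀ x, HasDerivAt z (z1 x) x) (hz1 : ∀ x, HasDerivAt z1 (z2 x) x) (hz2 : Continuous z2)
    (hper : z T = z 0) (hper1 : z1 T = z1 0) (N : ℤ) (d : ℝ)
    (hd : ∀ k : ℤ, d * (k * (k - N) : ℝ) ≤ (k * (k - N) : ℝ) ^ 2) :
    -((2 * Real.pi / T) ^ 2 * d *
        ∫ x in (0 : ℝ)..T, inner ℝ (z x) (z2 x - (2 * Real.pi * N / T : ℝ) * I * z1 x)) ≤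
      ∫ x in (0 : ℝ)..T, ‖z2 x - (2 * Real.pi * N / T : ℝ) * I * z1 x‖ ^ 2 := by
  have cz : Continuous z := continuous_iff_continuousAt.2 fun x => (hz x).continuousAt
  have cz1 : Continuous z1 := continuous_iff_continuousAt.2 fun x => (hz1 x).continuousAt
  refine integral_norm_sq_ge_of_fourierCoeffOn hT cz (by fun_prop)
    (fun k => (2 * Real.pi / T) ^ 2 * (k * (k - N) : ℝ)) _ (fun k => ?_) (fun k => ?_)
  · have h1 := fourierCoeffOn_deriv_of_periodic hT hz cz1 hper k
    have h2 := fourierCoeffOn_deriv_of_periodic hT hz1 hz2 hper1 k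
    have h3 := fourierCoeffOn_add_of_continuous hT hz2
      (g := fun x => (-((2 * Real.pi * N / T : ℝ) * I)) * z1 x) (by fun_prop) k
    rw [fourierCoeffOn.const_mul, h2, h1] at h3
    simp only [sub_eq_add_neg, neg_mul] at h3 ⊢
    rw [h3]
    push_cast
    linear_combination (2 * Real.pi / T) ^ 2 * (k * (k - N) : ℂ) * fourierCoeffOn hT z k * I_sq
  · have := mul_le_mul_of_nonneg_left (hd k) (sq_nonneg ((2 * Real.pi / T) ^ 2))
    nlinarith [this]

/-! ### Geometry of a single closed immersed curve -/

theorem real_inner_I_mul_self (a : ℂ) : inner ℝ a (Complex.I * a) = 0 := by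
  simp [Complex.inner]
  ring

theorem real_inner_I_mul_left (a b : ℂ) :
    inner ℝ (Complex.I * a) b = -inner ℝ a (Complex.I * b) := by
  simp [Complex.inner]
  ring

theorem hasDerivAt_norm_of_ne_zero {f : ℝ → ℂ} {f' : ℂ} {x : ℝ} (hf : HasDerivAt f f' x)
    (hx : f x ≠ 0) : HasDerivAt (fun y => ‖f y‖) (inner ℝ (f x) f' / ‖f x‖) x := by
  have h := hf.norm_sq.sqrt (pow_ne_zero 2 (norm_ne_zero_iff.2 hx))
  simp only [Real.sqrt_sq (norm_nonneg _)] at h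
  convert h using 1
  field_simp

/-- A closed immersed plane curve of class `C²`, of period `1`. -/
structure IsClosedImmersed (c : ℝ → ℂ) : Prop where
  periodic : Function.Periodic c 1
  contDiff : ContDiff ℝ 2 c
  immersed : ∀ u, deriv c u ≠ 0

namespace IsClosedImmersed

variable {c : ℝ → ℂ} (hc : IsClosedImmersed c)
include hc

theorem hasDerivAt (u : ℝ) : HasDerivAt c (deriv c u) u :=
  (hc.contDiff.differentiable (by norm_num) u).hasDerivAt

theorem contDiff_deriv : ContDiff ℝ 1 (deriv c) :=
  hc.contDiff.deriv' (n := 1)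

theorem hasDerivAt_deriv (u : ℝ) : HasDerivAt (deriv c) (deriv (deriv c) u) u :=
  (hc.contDiff_deriv.differentiable (by norm_num) u).hasDerivAt

theorem continuous : Continuous c := hc.contDiff.continuous

theorem continuous_deriv : Continuous (deriv c) := hc.contDiff_deriv.continuous

theorem continuous_deriv_deriv : Continuous (deriv (deriv c)) :=
  hc.contDiff_deriv.continuous_deriv le_rfl

theorem periodic_deriv : Function.Periodic (deriv c) 1 := fun u => by
  rw [← deriv_comp_add_const, show (fun x => c (x + 1)) = c from funext hc.periodic]

theorem norm_pos (u : ℝ) : 0 < ‖deriv c u‖ := norm_pos_iff.2 (hc.immersed u)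

theorem norm_ne_zero (u : ℝ) : ‖deriv c u‖ ≠ 0 := (hc.norm_pos u).ne'

theorem norm_smul_tangent (u : ℝ) : ‖deriv c u‖ • tangent c u = deriv c u := by
  rw [tangent, smul_smul, mul_inv_cancel₀ (hc.norm_ne_zero u), one_smul]

theorem norm_tangent (u : ℝ) : ‖tangent c u‖ = 1 := by
  rw [tangent, norm_smul, norm_inv, norm_norm, inv_mul_cancel₀ (hc.norm_ne_zero u)]

theorem norm_normal (u : ℝ) : ‖normal c u‖ = 1 := by
  rw [normal, norm_mul, hc.norm_tangent u, Complex.norm_I, one_mul]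

theorem continuous_tangent : Continuous (tangent c) :=
  (hc.continuous_deriv.norm.inv₀ hc.norm_ne_zero).smul hc.continuous_deriv

theorem continuous_normal : Continuous (normal c) :=
  continuous_const.mul hc.continuous_tangent

theorem differentiable_tangent : Differentiable ℝ (tangent c) := fun u =>
  (((hasDerivAt_norm_of_ne_zero (hc.hasDerivAt_deriv u) (hc.immersed u)).inv
    (hc.norm_ne_zero u)).smul (hc.hasDerivAt_deriv u)).differentiableAt

theorem inner_deriv_tangent_normal (u : ℝ) :
    inner ℝ (deriv (tangent c) u) (normal c u) =
      inner ℝ (deriv (deriv c) u) (Complex.I * deriv c u) / ‖deriv c u‖ ^ 2 := by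
  have h := (((hasDerivAt_norm_of_ne_zero (hc.hasDerivAt_deriv u) (hc.immersed u)).inv
    (hc.norm_ne_zero u)).smul (hc.hasDerivAt_deriv u)).deriv
  have h' : deriv (tangent c) u = _ := h
  rw [h', normal, tangent, mul_smul_comm, inner_add_left, real_inner_smul_left,
    real_inner_smul_left, real_inner_smul_right, real_inner_smul_right, real_inner_I_mul_self]
  have := hc.norm_ne_zero u
  simp only [Pi.inv_apply]
  field_simp
  ring

theorem curvature_mul_norm (u : ℝ) :
    curvature c u * ‖deriv c u‖ =
      inner ℝ (deriv (deriv c) u) (Complex.I * deriv c u) / ‖deriv c u‖ ^ 2 := by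
  rw [← hc.inner_deriv_tangent_normal, curvature, curvatureVector, real_inner_smul_left]
  field_simp [hc.norm_ne_zero u]

theorem curvature_eq (u : ℝ) :
    curvature c u =
      inner ℝ (deriv (deriv c) u) (Complex.I * deriv c u) / ‖deriv c u‖ ^ 3 := by
  have := hc.norm_ne_zero u
  rw [eq_div_iff (by positivity)]
  have h := hc.curvature_mul_norm u
  rw [eq_div_iff (by positivity)] at h
  linear_combination h

theorem continuous_curvature : Continuous (curvature c) := by
  rw [funext hc.curvature_eq]
  have h1 := hc.continuous_deriv
  have h2 := hc.continuous_deriv_deriv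
  exact (by fun_prop : Continuous fun u => inner ℝ (deriv (deriv c) u)
    (Complex.I * deriv c u)).div (by fun_prop) fun u => pow_ne_zero 3 (hc.norm_ne_zero u)

/-- The tangent has unit norm, so its derivative is orthogonal to it; in the plane only the normal
component remains. -/
theorem deriv_tangent (u : ℝ) :
    deriv (tangent c) u = (curvature c u * ‖deriv c u‖) • normal c u := by
  have h1 : inner ℝ (deriv (tangent c) u) (tangent c u) = 0 := by
    have hd := (hc.differentiable_tangent u).hasDerivAt.norm_sq.deriv
    have hconst : (‖tangent c ·‖ ^ 2) = fun _ => (1 : ℝ) := by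
      funext v
      simp [hc.norm_tangent v]
    rw [hconst, deriv_const, real_inner_comm] at hd
    linarith
  have h2 := hc.inner_deriv_tangent_normal u
  rw [← hc.curvature_mul_norm] at h2
  rw [← h2]
  have hn : Complex.normSq (tangent c u) = 1 := by
    rw [Complex.normSq_eq_norm_sq, hc.norm_tangent, one_pow]
  rw [Complex.normSq_apply] at hn
  simp only [normal, Complex.inner, Complex.mul_re, Complex.mul_im, Complex.conj_re,
    Complex.conj_im, Complex.I_re, Complex.I_im] at h1 ⊢
  apply Complex.ext
  · simp
    linear_combination (-(deriv (tangent c) u).re) * hn + (tangent c u).re * h1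
  · simp
    linear_combination (-(deriv (tangent c) u).im) * hn + (tangent c u).im * h1

theorem hasDerivAt_tangent (u : ℝ) :
    HasDerivAt (tangent c) ((curvature c u * ‖deriv c u‖) • normal c u) u :=
  hc.deriv_tangent u ▸ (hc.differentiable_tangent u).hasDerivAt

theorem tangent_periodic : Function.Periodic (tangent c) 1 := fun u => by
  simp only [tangent, hc.periodic_deriv u]

theorem intervalIntegrable_mul_norm {φ : ℝ → ℝ} (hφ : Continuous φ) (a b : ℝ) :
    IntervalIntegrable (fun u => φ u * ‖deriv c u‖) MeasureTheory.volume a b :=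
  (hφ.mul hc.continuous_deriv.norm).intervalIntegrable _ _

theorem arcIntegral_add {φ ψ : ℝ → ℝ} (hφ : Continuous φ) (hψ : Continuous ψ) :
    arcIntegral c (fun u => φ u + ψ u) = arcIntegral c φ + arcIntegral c ψ := by
  simp only [arcIntegral, add_mul]
  exact intervalIntegral.integral_add (hc.intervalIntegrable_mul_norm hφ _ _)
    (hc.intervalIntegrable_mul_norm hψ _ _)

omit hc in
theorem arcIntegral_const_mul (a : ℝ) (φ : ℝ → ℝ) :
    arcIntegral c (fun u => a * φ u) = a * arcIntegral c φ := by
  simp only [arcIntegral, mul_assoc, intervalIntegral.integral_const_mul]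

omit hc in
theorem arcIntegral_const (a : ℝ) : arcIntegral c (fun _ => a) = a * length c := by
  rw [length, ← arcIntegral_const_mul]
  simp

theorem length_pos : 0 < length c := by
  refine intervalIntegral.intervalIntegral_pos_of_pos_on
    (hc.intervalIntegrable_mul_norm continuous_const _ _) (fun u _ => ?_) one_pos
  simpa using hc.immersed u

/-- The arc length as a function of the parameter. -/
theorem exists_arcLength : ∃ σ ψ : ℝ → ℝ, σ 0 = 0 ∧ σ 1 = length c ∧
    (∀ u, HasDerivAt σ ‖deriv c u‖ u) ∧ (∀ u, ψ (σ u) = u) ∧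
    (∀ x, HasDerivAt ψ ‖deriv c (ψ x)‖⁻¹ x) := by
  have hcn : Continuous fun u => ‖deriv c u‖ := hc.continuous_deriv.norm
  have hper : Function.Periodic (fun u => ‖deriv c u‖) 1 := fun u => by
    simp only [hc.periodic_deriv u]
  set σ : ℝ → ℝ := fun u => ∫ v in (0 : ℝ)..u, ‖deriv c v‖ with hσ
  have hσd : ∀ u, HasDerivAt σ ‖deriv c u‖ u := fun u =>
    intervalIntegral.integral_hasDerivAt_right (hcn.intervalIntegrable _ _)
      (hcn.stronglyMeasurableAtFilter _ _) hcn.continuousAt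
  have hσ1 : σ 1 = length c := by simp [hσ, length, arcIntegral]
  have hpos : 0 < ∫ v in (0 : ℝ)..1, ‖deriv c v‖ := by
    have := hc.length_pos
    rwa [← hσ1] at this
  have hcont : Continuous σ := continuous_iff_continuousAt.2 fun u => (hσd u).continuousAt
  have hmono : StrictMono σ := strictMono_of_deriv_pos fun u => by
    rw [(hσd u).deriv]; exact hc.norm_pos u
  have hsurj : Function.Surjective σ := hcont.surjective
    (hper.tendsto_atTop_intervalIntegral_of_pos hpos one_pos)
    (hper.tendsto_atBot_intervalIntegral_of_pos hpos one_pos)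
  set e := hmono.orderIsoOfSurjective σ hsurj with he
  refine ⟨σ, e.symm, by simp [hσ], hσ1, hσd, fun u => e.symm_apply_apply u, fun x => ?_⟩
  exact HasDerivAt.of_local_left_inverse e.symm.continuous.continuousAt (hσd _)
    (hc.norm_ne_zero _) (Filter.Eventually.of_forall fun y => e.apply_symm_apply y)

/-- The function `⟪c, τ⟫` is periodic and has arc-length derivative `κ⟪c, ν⟫ + 1`, which thus
integrates to zero. -/
theorem arcIntegral_curvature_mul_inner_normal :
    arcIntegral c (fun u => curvature c u * inner ℝ (c u) (normal c u)) = -length c := by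
  have h : ∀ u, HasDerivAt (fun u => inner ℝ (c u) (tangent c u))
      ((curvature c u * inner ℝ (c u) (normal c u) + 1) * ‖deriv c u‖) u := fun u => by
    refine ((hc.hasDerivAt u).inner ℝ (hc.hasDerivAt_tangent u)).congr_deriv ?_
    rw [real_inner_smul_right, tangent, real_inner_smul_right, real_inner_self_eq_norm_sq]
    field_simp [hc.norm_ne_zero u]
  have hk := hc.continuous_curvature
  have hn := hc.continuous_normal
  have h0 := hc.continuous
  have hcont : Continuous fun u => curvature c u * inner ℝ (c u) (normal c u) := by fun_prop
  have hint := intervalIntegral.integral_eq_sub_of_hasDerivAt (a := 0) (b := 1) (fun u _ => h u)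
    (hc.intervalIntegrable_mul_norm (hcont.add continuous_const) _ _)
  have hadd := hc.arcIntegral_add hcont (continuous_const (y := (1 : ℝ)))
  have e1 : c 1 = c 0 := by simpa using hc.periodic 0
  have e2 : tangent c 1 = tangent c 0 := by simpa using hc.tangent_periodic 0
  rw [e1, e2, sub_self] at hint
  rw [show arcIntegral c (fun u => curvature c u * inner ℝ (c u) (normal c u) + 1) = 0 from hint,
    arcIntegral_const] at hadd
  linarith

/-- The arc-length form of the second order Wirtinger inequality. -/
theorem deficit_le_arcIntegral (N : ℤ) (d : ℝ)
    (hd : ∀ k : ℤ, d * (k * (k - N) : ℝ) ≤ (k * (k - N) : ℝ) ^ 2) :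
    (2 * Real.pi / length c) ^ 2 * d *
        (length c - 2 * (2 * Real.pi * N / length c) * area c) ≤
      arcIntegral c (fun u => (curvature c u - 2 * Real.pi * N / length c) ^ 2) := by
  obtain ⟨σ, ψ, hσ0, hσ1, hσ, hψσ, hψ⟩ := hc.exists_arcLength
  set ω : ℝ := 2 * Real.pi * N / length c with hω
  have cψ : Continuous ψ := continuous_iff_continuousAt.2 fun x => (hψ x).continuousAt
  have hk := hc.continuous_curvature
  have hn := hc.continuous_normal
  have h0 := hc.continuous
  have hsubst : ∀ φ : ℝ → ℝ, Continuous φ →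
      ∫ x in (0 : ℝ)..length c, φ (ψ x) = arcIntegral c φ := fun φ hφ => by
    have := intervalIntegral.integral_comp_mul_deriv (a := 0) (b := 1) (fun u _ => hσ u)
      hc.continuous_deriv.norm.continuousOn (hφ.comp cψ)
    rw [hσ0, hσ1] at this
    simpa [arcIntegral, Function.comp_def, hψσ] using this.symm
  have ψL : ψ (length c) = 1 := by rw [← hσ1, hψσ]
  have ψ0 : ψ 0 = 0 := by rw [← hσ0, hψσ, hσ0]
  have key := wirtinger_second_order hc.length_pos (z := fun x => c (ψ x))
    (z1 := fun x => tangent c (ψ x)) (z2 := fun x => curvature c (ψ x) • normal c (ψ x))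
    (fun x => (hc.hasDerivAt (ψ x)).scomp x (hψ x))
    (fun x => by
      have := (hc.hasDerivAt_tangent (ψ x)).scomp x (hψ x)
      rwa [smul_smul, mul_comm (curvature c (ψ x)), inv_mul_cancel_left₀ (hc.norm_ne_zero _)]
        at this)
    (by fun_prop) (by simpa [ψL, ψ0] using hc.periodic 0)
    (by simpa [ψL, ψ0] using hc.tangent_periodic 0) N d hd
  -- In arc length `z' = τ` and `z'' = κν`, and `iτ = ν`, so the operator of the Wirtinger
  -- inequality yields a purely normal vector. Here `N` need not be the rotation number.
  have hp : ∀ u, curvature c u • normal c u - (ω : ℂ) * Complex.I * tangent c u =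
      (curvature c u - ω) • normal c u := fun u => by
    simp only [normal, Complex.real_smul]
    push_cast
    ring
  simp only [← hω, hp, norm_smul, hc.norm_normal, mul_one, Real.norm_eq_abs, sq_abs,
    real_inner_smul_right] at key
  rw [hsubst (fun u => (curvature c u - ω) ^ 2) (by fun_prop),
    hsubst (fun u => (curvature c u - ω) * inner ℝ (c u) (normal c u)) (by fun_prop)] at key
  have hin : arcIntegral c (fun u => (curvature c u - ω) * inner ℝ (c u) (normal c u)) =
      -length c + 2 * ω * area c := by
    have := hc.arcIntegral_add
      (φ := fun u => curvature c u * inner ℝ (c u) (normal c u))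
      (ψ := fun u => -ω * inner ℝ (c u) (normal c u)) (by fun_prop) (by fun_prop)
    rw [arcIntegral_const_mul, hc.arcIntegral_curvature_mul_inner_normal] at this
    simp only [sub_eq_add_neg, add_mul, this, area]
    ring
  rw [hin] at key
  linarith

/-- If `θ` is the accumulated curvature, then `exp(-iθ)τ` is constant. Since `τ` closes up,
`exp(-iθ(1)) = 1`. -/
theorem exists_totalCurvature_eq : ∃ k : ℤ, totalCurvature c = 2 * Real.pi * k := by
  have hcn : Continuous fun u => curvature c u * ‖deriv c u‖ :=
    hc.continuous_curvature.mul hc.continuous_deriv.norm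
  set θ : ℝ → ℝ := fun u => ∫ v in (0 : ℝ)..u, curvature c v * ‖deriv c v‖ with hθ
  have hθd : ∀ u, HasDerivAt θ (curvature c u * ‖deriv c u‖) u := fun u =>
    intervalIntegral.integral_hasDerivAt_right (hcn.intervalIntegrable _ _)
      (hcn.stronglyMeasurableAtFilter _ _) hcn.continuousAt
  have hd : ∀ u, HasDerivAt (fun u => Complex.exp (-(θ u * Complex.I)) * tangent c u) 0 u := by
    intro u
    refine ((((hθd u).ofReal_comp.mul_const Complex.I).neg.cexp).mul
      (hc.hasDerivAt_tangent u)).congr_deriv ?_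
    simp only [normal, Complex.real_smul]
    ring
  have hconst := is_const_of_deriv_eq_zero (fun u => (hd u).differentiableAt)
    (fun u => (hd u).deriv) 1 0
  have e2 : tangent c 1 = tangent c 0 := by simpa using hc.tangent_periodic 0
  have ht : tangent c 0 ≠ 0 := norm_ne_zero_iff.1 (by simp [hc.norm_tangent])
  simp only [e2, hθ, intervalIntegral.integral_same] at hconst
  have h1 := mul_right_cancel₀ ht hconst
  simp only [Complex.ofReal_zero, zero_mul, neg_zero, Complex.exp_zero, Complex.exp_neg,
    inv_eq_one, Complex.exp_eq_one_iff] at h1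
  obtain ⟨k, hk⟩ := h1
  refine ⟨k, ?_⟩
  have := congrArg Complex.im hk
  simpa [totalCurvature, arcIntegral, mul_comm] using this

/-- For `N = 1` the numbers `k(k - 1)` are nonnegative, so every negative `d` is admissible in the
Wirtinger inequality; letting `d → -∞` rules out `L² < 4πA`. The rotation number plays no role. -/
theorem isoperimetric : 4 * Real.pi * area c ≤ length c ^ 2 := by
  by_contra! hlt
  have hL := hc.length_pos
  have hm : ∀ k : ℤ, (0 : ℝ) ≤ k * (k - (1 : ℤ)) := fun k => by
    have : 0 ≤ k * (k - 1) := by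
      rcases le_or_gt k 0 with h | h <;> nlinarith
    exact_mod_cast this
  set E := length c - 2 * (2 * Real.pi * (1 : ℤ) / length c) * area c with hE
  have hEneg : E < 0 := by
    have : E = (length c ^ 2 - 4 * Real.pi * area c) / length c := by
      rw [hE]
      field_simp
      push_cast
      ring
    rw [this]
    exact div_neg_of_neg_of_pos (by linarith) hL
  set J := arcIntegral c (fun u => (curvature c u - 2 * Real.pi * (1 : ℤ) / length c) ^ 2)
  have hω : 0 < (2 * Real.pi / length c) ^ 2 := by positivity
  have hωE : (2 * Real.pi / length c) ^ 2 * E < 0 := mul_neg_of_pos_of_neg hω hEneg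
  set B := (2 * Real.pi / length c) ^ 2 * E
  -- This `d` is negative and makes the left-hand side equal to `|J| + 1`, which exceeds `J`.
  have key := hc.deficit_le_arcIntegral 1 (-(|J| + 1) / (-B)) fun k =>
    (mul_nonpos_of_nonpos_of_nonneg (div_nonpos_of_nonpos_of_nonneg
      (by linarith [abs_nonneg J]) (by linarith)) (hm k)).trans (sq_nonneg _)
  have : (2 * Real.pi / length c) ^ 2 * (-(|J| + 1) / (-B)) * E = |J| + 1 := by
    have hB : B ≠ 0 := hωE.ne
    rw [show (2 * Real.pi / length c) ^ 2 * (-(|J| + 1) / (-B)) * E = B * (-(|J| + 1) / (-B)) by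
      ring]
    field_simp
  rw [← hE, this] at key
  change _ ≤ J at key
  linarith [le_abs_self J]

end IsClosedImmersed

/-! ### Time regularity of integral functionals -/

open MeasureTheory in
theorem continuousOn_Ici_intervalIntegral {F : ℝ → ℝ → ℝ}
    (hF : ContinuousOn (fun p : ℝ × ℝ => F p.1 p.2) (Set.Ici 0 ×ˢ Set.univ)) :
    ContinuousOn (fun t => ∫ u in (0 : ℝ)..1, F t u) (Set.Ici 0) := by
  -- Clamping time at `0` extends the integrand continuously to the whole plane.
  have h1 : Continuous fun p : ℝ × ℝ => F (max p.1 0) p.2 :=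
    hF.comp_continuous (f := fun p : ℝ × ℝ => (max p.1 0, p.2)) (by fun_prop) fun p =>
      ⟨Set.mem_Ici.2 (le_max_right _ _), trivial⟩
  have h2 : Continuous fun t => ∫ u in (0 : ℝ)..1, F (max t 0) u :=
    intervalIntegral.continuous_parametric_intervalIntegral_of_continuous' h1 0 1
  refine h2.continuousOn.congr fun t ht => ?_
  simp only [max_eq_left (Set.mem_Ici.1 ht)]

open MeasureTheory Filter Topology in
/-- Differentiation in time of a functional whose increments are integrals of the increments
of `Φ` against a continuous kernel. -/
theorem hasDerivAt_of_sub_eq_integral_inner {Φ G : ℝ → ℝ → ℂ} {f : ℝ → ℝ} {t : ℝ} (ht : 0 < t)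
    (hΦ : ∀ r, 0 < r → Continuous (Φ r))
    (hdiff : ∀ r, 0 < r → ∀ u, DifferentiableAt ℝ (fun r => Φ r u) r)
    (hderiv : ContinuousOn (fun p : ℝ × ℝ => deriv (fun r => Φ r p.2) p.1)
      (Set.Ioi 0 ×ˢ Set.univ))
    (hG : ContinuousOn (fun p : ℝ × ℝ => G p.1 p.2) (Set.Ioi 0 ×ˢ Set.univ))
    (hf : ∀ r, 0 < r → f r - f t = ∫ u in (0 : ℝ)..1, inner ℝ (Φ r u - Φ t u) (G r u)) :
    HasDerivAt f (∫ u in (0 : ℝ)..1, inner ℝ (deriv (fun r => Φ r u) t) (G t u)) t := by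
  have hsub : Set.Icc (t / 2) (2 * t) ×ˢ Set.Icc (0 : ℝ) 1 ⊆ Set.Ioi 0 ×ˢ Set.univ :=
    Set.prod_mono (fun r hr => lt_of_lt_of_le (half_pos ht) hr.1) (Set.subset_univ _)
  have hcpt : IsCompact (Set.Icc (t / 2) (2 * t) ×ˢ Set.Icc (0 : ℝ) 1) :=
    isCompact_Icc.prod isCompact_Icc
  obtain ⟨C1, hC1⟩ := hcpt.exists_bound_of_continuousOn (hderiv.mono hsub)
  obtain ⟨C2, hC2⟩ := hcpt.exists_bound_of_continuousOn (hG.mono hsub)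
  have htm : t ∈ Set.Icc (t / 2) (2 * t) := ⟨by linarith, by linarith⟩
  have hnear : ∀ᶠ r in 𝓝[≠] t, r ∈ Set.Icc (t / 2) (2 * t) :=
    mem_nhdsWithin_of_mem_nhds (Icc_mem_nhds (by linarith) (by linarith))
  have hGu : ∀ r, 0 < r → Continuous (G r) := fun r hr =>
    hG.comp_continuous (f := fun u => (r, u)) (by fun_prop) fun u => ⟨hr, trivial⟩
  rw [hasDerivAt_iff_tendsto_slope]
  have hslope : ∀ᶠ r in 𝓝[≠] t,
      ∫ u in (0 : ℝ)..1, inner ℝ ((r - t)⁻¹ • (Φ r u - Φ t u)) (G r u) = slope f t r := by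
    filter_upwards [hnear] with r hr
    rw [slope_def_field, hf r (lt_of_lt_of_le (half_pos ht) hr.1), div_eq_inv_mul,
      ← intervalIntegral.integral_const_mul]
    simp only [real_inner_smul_left]
  refine Tendsto.congr' hslope ?_
  refine intervalIntegral.tendsto_integral_filter_of_dominated_convergence (fun _ => C1 * C2)
    ?_ ?_ (by simp) ?_
  · filter_upwards [hnear] with r hr
    have hr0 : 0 < r := lt_of_lt_of_le (half_pos ht) hr.1
    exact ((((hΦ r hr0).sub (hΦ t ht)).const_smul (r - t)⁻¹).inner (𝕜 := ℝ)
      (hGu r hr0)).aestronglyMeasurable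
  · filter_upwards [hnear, self_mem_nhdsWithin] with r hr hrt
    refine Eventually.of_forall fun u hu => ?_
    rw [Set.uIoc_of_le zero_le_one] at hu
    have hu' : u ∈ Set.Icc (0 : ℝ) 1 := ⟨hu.1.le, hu.2⟩
    have hne : 0 < |r - t| := abs_pos.2 (sub_ne_zero.2 hrt)
    -- The mean value inequality bounds the difference quotients uniformly in `r` and `u`, which
    -- supplies the dominating constant.
    have h1 : ‖Φ r u - Φ t u‖ ≤ C1 * ‖r - t‖ :=
      (convex_Icc (t / 2) (2 * t)).norm_image_sub_le_of_norm_deriv_le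
        (fun x hx => hdiff x (lt_of_lt_of_le (half_pos ht) hx.1) u)
        (fun x hx => hC1 (x, u) ⟨hx, hu'⟩) htm hr
    have h2 : ‖(r - t)⁻¹ • (Φ r u - Φ t u)‖ ≤ C1 := by
      rw [norm_smul, norm_inv, Real.norm_eq_abs, inv_mul_le_iff₀ hne, mul_comm]
      exact h1
    exact (norm_inner_le_norm _ _).trans
      (mul_le_mul h2 (hC2 (r, u) ⟨hr, hu'⟩) (norm_nonneg _) ((norm_nonneg _).trans h2))
  · refine Eventually.of_forall fun u _ => ?_
    have h1 : Tendsto (fun r => (r - t)⁻¹ • (Φ r u - Φ t u)) (𝓝[≠] t)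
        (𝓝 (deriv (fun r => Φ r u) t)) := by
      have := hasDerivAt_iff_tendsto_slope.1 (hdiff t ht u).hasDerivAt
      simpa only [slope_fun_def, vsub_eq_sub] using this
    have h2 : Tendsto (fun r => G r u) (𝓝[≠] t) (𝓝 (G t u)) := by
      have h3 : ContinuousAt (fun p : ℝ × ℝ => G p.1 p.2) (t, u) :=
        hG.continuousAt (prod_mem_nhds (Ioi_mem_nhds ht) univ_mem)
      exact (h3.comp (f := fun r : ℝ => (r, u)) (by fun_prop)).tendsto.mono_left
        nhdsWithin_le_nhds
    exact h1.inner h2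

/-- The derivative of `(a + b) / (‖a‖ + ‖b‖)`, if `a` and `b` have the derivatives `a'`, `b'`. -/
noncomputable def meanTangentDeriv (a a' b b' : ℂ) : ℂ :=
  (‖a‖ + ‖b‖)⁻¹ • (a' + b') +
    (-(inner ℝ a a' / ‖a‖ + inner ℝ b b' / ‖b‖) / (‖a‖ + ‖b‖) ^ 2) • (a + b)

theorem hasDerivAt_meanTangent {f g : ℝ → ℂ} {f' g' : ℂ} {x : ℝ} (hf : HasDerivAt f f' x)
    (hg : HasDerivAt g g' x) (hfx : f x ≠ 0) (hgx : g x ≠ 0) :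
    HasDerivAt (fun y => (‖f y‖ + ‖g y‖)⁻¹ • (f y + g y))
      (meanTangentDeriv (f x) f' (g x) g') x :=
  (((hasDerivAt_norm_of_ne_zero hf hfx).add (hasDerivAt_norm_of_ne_zero hg hgx)).inv
    (add_pos (norm_pos_iff.2 hfx) (norm_pos_iff.2 hgx)).ne').smul (hf.add hg)

/-- This is `‖a‖² - ‖b‖² = ⟪a - b, a + b⟫` divided by `‖a‖ + ‖b‖`. It makes the increment of length
linear in the difference of the derivatives, hence open to integration by parts. -/
theorem norm_sub_norm_eq_inner {a b : ℂ} (ha : a ≠ 0) :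
    ‖a‖ - ‖b‖ = inner ℝ (a - b) ((‖a‖ + ‖b‖)⁻¹ • (a + b)) := by
  have h : 0 < ‖a‖ + ‖b‖ := add_pos_of_pos_of_nonneg (norm_pos_iff.2 ha) (norm_nonneg _)
  rw [real_inner_smul_right, inner_sub_left, inner_add_right, inner_add_right,
    real_inner_self_eq_norm_sq, real_inner_self_eq_norm_sq, real_inner_comm b a]
  field_simp
  ring

theorem ContinuousOn.meanTangentDeriv {X : Type*} [TopologicalSpace X] {s : Set X}
    {a a' b b' : X → ℂ} (ha : ContinuousOn a s) (ha' : ContinuousOn a' s) (hb : ContinuousOn b s)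
    (hb' : ContinuousOn b' s) (ha0 : ∀ x ∈ s, a x ≠ 0) (hb0 : ∀ x ∈ s, b x ≠ 0) :
    ContinuousOn (fun x => _root_.meanTangentDeriv (a x) (a' x) (b x) (b' x)) s := by
  have h1 : ∀ x ∈ s, ‖a x‖ ≠ 0 := fun x hx => norm_ne_zero_iff.2 (ha0 x hx)
  have h2 : ∀ x ∈ s, ‖b x‖ ≠ 0 := fun x hx => norm_ne_zero_iff.2 (hb0 x hx)
  have h3 : ∀ x ∈ s, ‖a x‖ + ‖b x‖ ≠ 0 := fun x hx =>
    (add_pos (norm_pos_iff.2 (ha0 x hx)) (norm_pos_iff.2 (hb0 x hx))).ne'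
  unfold _root_.meanTangentDeriv
  exact (((ha.norm.add hb.norm).inv₀ h3).smul (ha'.add hb')).add
    ((((((ha.inner ha').div ha.norm h1).add ((hb.inner hb').div hb.norm h2)).neg).div
      ((ha.norm.add hb.norm).pow 2) (fun x hx => pow_ne_zero 2 (h3 x hx))).smul (ha.add hb))

/-! ### Exact increments of area and length -/

namespace IsClosedImmersed

variable {b c : ℝ → ℂ}

theorem area_eq (hc : IsClosedImmersed c) :
    area c = ∫ u in (0 : ℝ)..1, -(1 / 2) * inner ℝ (c u) (Complex.I * deriv c u) := by
  rw [area, arcIntegral, ← intervalIntegral.integral_const_mul]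
  refine intervalIntegral.integral_congr fun u _ => ?_
  simp only [← real_inner_smul_right, mul_comm (inner ℝ (c u) (normal c u))]
  rw [normal, ← mul_smul_comm, hc.norm_smul_tangent]

theorem length_eq (c : ℝ → ℂ) : length c = ∫ u in (0 : ℝ)..1, ‖deriv c u‖ := by
  simp [length, arcIntegral]

theorem totalCurvature_eq (hc : IsClosedImmersed c) :
    totalCurvature c = ∫ u in (0 : ℝ)..1,
      inner ℝ (deriv (deriv c) u) (Complex.I * deriv c u) / ‖deriv c u‖ ^ 2 := by
  simp only [totalCurvature, arcIntegral, hc.curvature_mul_norm]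

theorem area_sub_area (hb : IsClosedImmersed b) (hc : IsClosedImmersed c) :
    area b - area c = ∫ u in (0 : ℝ)..1,
      inner ℝ (b u - c u) ((-(1 / 2) : ℝ) • (Complex.I * (deriv b u + deriv c u))) := by
  have b0 := hb.continuous
  have c0 := hc.continuous
  have b1 := hb.continuous_deriv
  have c1 := hc.continuous_deriv
  -- The difference between the two sides of the claim is this total derivative, whose integral over
  -- a period vanishes.
  have hd : ∀ u, HasDerivAt (fun u => -(1 / 2) * inner ℝ (c u) (Complex.I * b u))
      (-(1 / 2) * (inner ℝ (c u) (Complex.I * deriv b u) +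
        inner ℝ (deriv c u) (Complex.I * b u))) u := fun u =>
    ((hc.hasDerivAt u).inner ℝ ((hb.hasDerivAt u).const_mul Complex.I)).const_mul _
  have hint := intervalIntegral.integral_eq_sub_of_hasDerivAt (a := 0) (b := 1) (fun u _ => hd u)
    (Continuous.intervalIntegrable (by fun_prop) _ _)
  have e1 : b 1 = b 0 := by simpa using hb.periodic 0
  have e2 : c 1 = c 0 := by simpa using hc.periodic 0
  rw [e1, e2, sub_self] at hint
  rw [hb.area_eq, hc.area_eq, ← intervalIntegral.integral_sub
    (Continuous.intervalIntegrable (by fun_prop) _ _)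
    (Continuous.intervalIntegrable (by fun_prop) _ _)]
  refine eq_of_sub_eq_zero ?_
  rw [← intervalIntegral.integral_sub (Continuous.intervalIntegrable (by fun_prop) _ _)
    (Continuous.intervalIntegrable (by fun_prop) _ _)]
  refine (intervalIntegral.integral_congr fun u _ => ?_).trans hint
  have h := real_inner_I_mul_left (b u) (deriv c u)
  rw [real_inner_comm] at h
  simp only [real_inner_smul_right, mul_add, inner_add_right, inner_sub_left, h]
  ring

/-- `‖b'‖ - ‖c'‖` is the inner product of `b' - c'` with the mean tangent; integrating by parts over
a period moves the derivative onto the mean tangent. Only values of `b - c` remain, so a time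
derivative of the position is enough. -/
theorem length_sub_length (hb : IsClosedImmersed b) (hc : IsClosedImmersed c) :
    length b - length c = ∫ u in (0 : ℝ)..1, inner ℝ (b u - c u)
      (-meanTangentDeriv (deriv b u) (deriv (deriv b) u) (deriv c u) (deriv (deriv c) u)) := by
  have b0 := hb.continuous
  have c0 := hc.continuous
  have b1 := hb.continuous_deriv
  have c1 := hc.continuous_deriv
  set w : ℝ → ℂ := fun u => (‖deriv b u‖ + ‖deriv c u‖)⁻¹ • (deriv b u + deriv c u) with hw
  set W : ℝ → ℂ := fun u =>
    meanTangentDeriv (deriv b u) (deriv (deriv b) u) (deriv c u) (deriv (deriv c) u) with hW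
  have hwd : ∀ u, HasDerivAt w (W u) u := fun u =>
    hasDerivAt_meanTangent (hb.hasDerivAt_deriv u) (hc.hasDerivAt_deriv u) (hb.immersed u)
      (hc.immersed u)
  have hwc : Continuous w := continuous_iff_continuousAt.2 fun u => (hwd u).continuousAt
  have hWc : Continuous W := continuousOn_univ.1 <|
    ContinuousOn.meanTangentDeriv b1.continuousOn hb.continuous_deriv_deriv.continuousOn
      c1.continuousOn hc.continuous_deriv_deriv.continuousOn (fun u _ => hb.immersed u)
      (fun u _ => hc.immersed u)
  have hd : ∀ u, HasDerivAt (fun u => inner ℝ (b u - c u) (w u))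
      (inner ℝ (b u - c u) (W u) + inner ℝ (deriv b u - deriv c u) (w u)) u := fun u =>
    ((hb.hasDerivAt u).sub (hc.hasDerivAt u)).inner ℝ (hwd u)
  have hint := intervalIntegral.integral_eq_sub_of_hasDerivAt (a := 0) (b := 1) (fun u _ => hd u)
    (Continuous.intervalIntegrable (by fun_prop) _ _)
  have e1 : b 1 = b 0 := by simpa using hb.periodic 0
  have e2 : c 1 = c 0 := by simpa using hc.periodic 0
  have e3 : w 1 = w 0 := by
    simp only [hw, show deriv b 1 = deriv b 0 by simpa using hb.periodic_deriv 0,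
      show deriv c 1 = deriv c 0 by simpa using hc.periodic_deriv 0]
  rw [e1, e2, e3, sub_self] at hint
  change _ = ∫ u in (0 : ℝ)..1, inner ℝ (b u - c u) (-W u)
  rw [length_eq, length_eq, ← intervalIntegral.integral_sub
    (Continuous.intervalIntegrable (by fun_prop) _ _)
    (Continuous.intervalIntegrable (by fun_prop) _ _)]
  refine eq_of_sub_eq_zero ?_
  rw [← intervalIntegral.integral_sub (Continuous.intervalIntegrable (by fun_prop) _ _)
    (Continuous.intervalIntegrable (by fun_prop) _ _)]
  refine (intervalIntegral.integral_congr fun u _ => ?_).trans hint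
  simp only [inner_neg_right, hW, norm_sub_norm_eq_inner (hb.immersed u), hw]
  ring

/-- For coinciding curves the mean tangent is the unit tangent, so its derivative is given by the
Frenet equation. -/
theorem meanTangentDeriv_self (hc : IsClosedImmersed c) (u : ℝ) :
    meanTangentDeriv (deriv c u) (deriv (deriv c) u) (deriv c u) (deriv (deriv c) u) =
      (curvature c u * ‖deriv c u‖) • normal c u := by
  have h := hasDerivAt_meanTangent (hc.hasDerivAt_deriv u) (hc.hasDerivAt_deriv u)
    (hc.immersed u) (hc.immersed u)
  refine HasDerivAt.unique (h.congr_of_eventuallyEq (Filter.Eventually.of_forall fun v => ?_))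
    (hc.hasDerivAt_tangent u)
  have := hc.norm_ne_zero v
  simp only [tangent, ← two_smul ℝ (deriv c v), smul_smul]
  congr 1
  field_simp
  norm_num

end IsClosedImmersed

/-! ### Integrals of the curvature deviation -/

namespace IsClosedImmersed

variable {c : ℝ → ℂ} (hc : IsClosedImmersed c)
include hc

theorem continuous_curvatureDeviation : Continuous (curvatureDeviation c) :=
  hc.continuous_curvature.sub continuous_const

theorem arcIntegral_curvatureDeviation : arcIntegral c (curvatureDeviation c) = 0 := by
  have h := hc.arcIntegral_add hc.continuous_curvature
    (continuous_const (y := -(1 / length c * totalCurvature c)))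
  rw [arcIntegral_const] at h
  simp only [← sub_eq_add_neg] at h
  change arcIntegral c (curvatureDeviation c) = totalCurvature c + _ at h
  rw [h]
  field_simp [hc.length_pos.ne']
  ring

theorem arcIntegral_curvatureDeviation_sub (a : ℝ) :
    arcIntegral c (fun u => curvatureDeviation c u - a) = -(a * length c) := by
  have h := hc.arcIntegral_add hc.continuous_curvatureDeviation (continuous_const (y := -a))
  rw [arcIntegral_const, hc.arcIntegral_curvatureDeviation] at h
  simpa only [sub_eq_add_neg, zero_add, neg_mul] using h

theorem arcIntegral_curvature_mul_curvatureDeviation_sub (a : ℝ) :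
    arcIntegral c (fun u => curvature c u * (curvatureDeviation c u - a)) =
      arcIntegral c (fun u => curvatureDeviation c u ^ 2) - a * totalCurvature c := by
  have hk := hc.continuous_curvatureDeviation
  have e : ∀ u, curvature c u * (curvatureDeviation c u - a) =
      curvatureDeviation c u ^ 2 + (totalCurvature c / length c * (curvatureDeviation c u - a) +
        -a * curvatureDeviation c u) := fun u => by
    simp only [curvatureDeviation]
    ring
  simp only [e]
  rw [hc.arcIntegral_add (by fun_prop) (by fun_prop), hc.arcIntegral_add (by fun_prop)
    (by fun_prop), arcIntegral_const_mul, arcIntegral_const_mul,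
    hc.arcIntegral_curvatureDeviation, hc.arcIntegral_curvatureDeviation_sub]
  field_simp [hc.length_pos.ne']
  ring

omit hc in
theorem arcIntegral_curvatureDeviation_sq_nonneg :
    0 ≤ arcIntegral c (fun u => curvatureDeviation c u ^ 2) :=
  intervalIntegral.integral_nonneg zero_le_one fun _ _ =>
    mul_nonneg (sq_nonneg _) (norm_nonneg _)

/-- When `N` is the rotation number, `2πN/L` is the mean curvature, and the Wirtinger inequality
bounds the deviation itself. -/
theorem mul_le_arcIntegral_curvatureDeviation_sq {N : ℤ}
    (hN : totalCurvature c = 2 * Real.pi * N) (d : ℝ)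
    (hd : ∀ k : ℤ, d * (k * (k - N) : ℝ) ≤ (k * (k - N) : ℝ) ^ 2) :
    4 * Real.pi ^ 2 * d * (length c ^ 2 - 4 * Real.pi * N * area c) ≤
      length c ^ 3 * arcIntegral c (fun u => curvatureDeviation c u ^ 2) := by
  have h := hc.deficit_le_arcIntegral N d hd
  have hL := hc.length_pos
  have e : ∀ u, curvature c u - 2 * Real.pi * N / length c = curvatureDeviation c u := fun u => by
    rw [curvatureDeviation, hN]
    ring
  simp only [e] at h
  refine le_trans (le_of_eq ?_) (mul_le_mul_of_nonneg_left h (pow_pos hL 3).le)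
  field_simp
  ring

end IsClosedImmersed

/-! ### Evolution of total curvature, length and area -/

namespace CurveFlow.IsGlobalClassicalSolution

variable {F : FlowKind} {γ : ℝ → ℝ → ℂ} (hγ : IsGlobalClassicalSolution F γ)
include hγ

theorem isClosedImmersed {t : ℝ} (ht : 0 ≤ t) : IsClosedImmersed (γ t) :=
  ⟨hγ.periodic t ht, hγ.contDiff t ht, hγ.immersed t ht⟩

theorem continuousOn_length : ContinuousOn (fun t => CurveFlow.length (γ t)) (Set.Ici 0) :=
  (continuousOn_Ici_intervalIntegral hγ.continuousOn_deriv.norm).congr fun _ _ =>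
    IsClosedImmersed.length_eq _

theorem continuousOn_area : ContinuousOn (fun t => area (γ t)) (Set.Ici 0) := by
  have h := hγ.continuousOn.inner (𝕜 := ℝ)
    ((continuousOn_const (c := Complex.I)).mul hγ.continuousOn_deriv)
  exact (continuousOn_Ici_intervalIntegral ((continuousOn_const (c := (-(1 / 2) : ℝ))).mul h)).congr
    fun t ht => (hγ.isClosedImmersed ht).area_eq

theorem continuousOn_totalCurvature :
    ContinuousOn (fun t => totalCurvature (γ t)) (Set.Ici 0) := by
  have h := (hγ.continuousOn_deriv_deriv.inner (𝕜 := ℝ)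
    ((continuousOn_const (c := Complex.I)).mul hγ.continuousOn_deriv)).div
    (hγ.continuousOn_deriv.norm.pow 2) fun p hp =>
      pow_ne_zero 2 (norm_ne_zero_iff.2 (hγ.immersed p.1 hp.1 p.2))
  exact (continuousOn_Ici_intervalIntegral h).congr
    fun t ht => (hγ.isClosedImmersed ht).totalCurvature_eq

/-- Divided by `2π`, the total curvature is continuous and integer-valued on the connected half
line. -/
theorem totalCurvature_eq_initial {t : ℝ} (ht : 0 ≤ t) :
    totalCurvature (γ t) = totalCurvature (γ 0) := by
  have hpi := Real.pi_pos
  have hdisc : DiscreteTopology (Set.range ((↑) : ℤ → ℝ)) :=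
    Int.isClosedEmbedding_coe_real.isEmbedding.toHomeomorph.symm.isEmbedding.discreteTopology
  have h := (isPreconnected_Ici (a := (0 : ℝ))).constant_of_mapsTo ⟨hdisc⟩
    (hγ.continuousOn_totalCurvature.div_const (2 * Real.pi))
    (fun s hs => by
      obtain ⟨k, hk⟩ := (hγ.isClosedImmersed hs).exists_totalCurvature_eq
      exact ⟨k, by simp only [hk]; field_simp⟩)
    (Set.mem_Ici.2 ht) (Set.mem_Ici.2 le_rfl)
  field_simp at h
  exact h

/-- In the limit `r → t` the kernel of the increment formula becomes `-κ‖∂ᵤγ‖ν`, so only the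
prescribed normal velocity enters. -/
theorem hasDerivAt_length {t : ℝ} (ht : 0 < t) :
    HasDerivAt (fun t => CurveFlow.length (γ t))
      (-arcIntegral (γ t) (fun u => curvatureDeviation (γ t) u ^ 2) +
        nonlocalTerm F (γ t) / CurveFlow.length (γ t) * totalCurvature (γ t)) t := by
  have hc := hγ.isClosedImmersed ht.le
  have hs : Set.Ioi (0 : ℝ) ×ˢ (Set.univ : Set ℝ) ⊆ Set.Ici 0 ×ˢ Set.univ :=
    Set.prod_mono Set.Ioi_subset_Ici_self subset_rfl
  have hfix : Set.MapsTo (fun p : ℝ × ℝ => (t, p.2)) (Set.Ioi (0 : ℝ) ×ˢ (Set.univ : Set ℝ))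
      (Set.Ici 0 ×ˢ Set.univ) := fun p _ => ⟨ht.le, trivial⟩
  have hfc : ContinuousOn (fun p : ℝ × ℝ => (t, p.2)) (Set.Ioi (0 : ℝ) ×ˢ (Set.univ : Set ℝ)) := by
    fun_prop
  have h := hasDerivAt_of_sub_eq_integral_inner ht
    (fun r hr => (hγ.isClosedImmersed hr.le).continuous)
    hγ.differentiableAt_time hγ.continuousOn_deriv_time
    (ContinuousOn.neg <| ContinuousOn.meanTangentDeriv (hγ.continuousOn_deriv.mono hs)
      (hγ.continuousOn_deriv_deriv.mono hs) (hγ.continuousOn_deriv.comp hfc hfix)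
      (hγ.continuousOn_deriv_deriv.comp hfc hfix)
      (fun p hp => hγ.immersed p.1 (le_of_lt hp.1) p.2) fun p _ => hγ.immersed t ht.le p.2)
    (fun r hr => (hγ.isClosedImmersed hr.le).length_sub_length hc)
  refine h.congr_deriv ?_
  have e := hc.arcIntegral_curvature_mul_curvatureDeviation_sub
    (nonlocalTerm F (γ t) / CurveFlow.length (γ t))
  rw [neg_add_eq_sub, ← neg_sub, ← e, arcIntegral, ← intervalIntegral.integral_neg]
  refine intervalIntegral.integral_congr fun u _ => ?_
  simp only [hc.meanTangentDeriv_self, inner_neg_right,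
    real_inner_smul_right, hγ.equation t ht]
  ring

theorem hasDerivAt_area {t : ℝ} (ht : 0 < t) :
    HasDerivAt (fun t => area (γ t)) (nonlocalTerm F (γ t)) t := by
  have hc := hγ.isClosedImmersed ht.le
  have hs : Set.Ioi (0 : ℝ) ×ˢ (Set.univ : Set ℝ) ⊆ Set.Ici 0 ×ˢ Set.univ :=
    Set.prod_mono Set.Ioi_subset_Ici_self subset_rfl
  have hfix : Set.MapsTo (fun p : ℝ × ℝ => (t, p.2)) (Set.Ioi (0 : ℝ) ×ˢ (Set.univ : Set ℝ))
      (Set.Ici 0 ×ˢ Set.univ) := fun p _ => ⟨ht.le, trivial⟩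
  have hfc : ContinuousOn (fun p : ℝ × ℝ => (t, p.2)) (Set.Ioi (0 : ℝ) ×ˢ (Set.univ : Set ℝ)) := by
    fun_prop
  have h := hasDerivAt_of_sub_eq_integral_inner ht
    (fun r hr => (hγ.isClosedImmersed hr.le).continuous)
    hγ.differentiableAt_time hγ.continuousOn_deriv_time
    (((continuousOn_const (c := Complex.I)).mul ((hγ.continuousOn_deriv.mono hs).add
      (hγ.continuousOn_deriv.comp hfc hfix))).const_smul (-(1 / 2) : ℝ))
    (fun r hr => (hγ.isClosedImmersed hr.le).area_sub_area hc)
  refine h.congr_deriv ?_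
  have e := hc.arcIntegral_curvatureDeviation_sub
    (nonlocalTerm F (γ t) / CurveFlow.length (γ t))
  rw [div_mul_cancel₀ _ hc.length_pos.ne'] at e
  rw [← neg_neg (nonlocalTerm F (γ t)), ← e, arcIntegral, ← intervalIntegral.integral_neg]
  refine intervalIntegral.integral_congr fun u _ => ?_
  have hn : Complex.I * deriv (γ t) u = ‖deriv (γ t) u‖ • normal (γ t) u := by
    rw [normal, ← mul_smul_comm, hc.norm_smul_tangent]
  simp only [← two_smul ℝ (deriv (γ t) u), mul_smul_comm, hn,
    real_inner_smul_right, hγ.equation t ht]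
  ring

end CurveFlow.IsGlobalClassicalSolution

/-! ### Monotonicity and differential inequalities on a half line -/

theorem antitoneOn_Ici_of_hasDerivAt {f f' : ℝ → ℝ} {a : ℝ} (hc : ContinuousOn f (Set.Ici a))
    (hd : ∀ t, a < t → HasDerivAt f (f' t) t) (hf' : ∀ t, a < t → f' t ≤ 0) :
    AntitoneOn f (Set.Ici a) := by
  refine antitoneOn_of_deriv_nonpos (convex_Ici a) hc ?_ ?_ <;> rw [interior_Ici]
  · exact fun t ht => (hd t ht).differentiableAt.differentiableWithinAt
  · exact fun t ht => (hd t ht).deriv ▸ hf' t ht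

theorem antitoneOn_Icc_of_hasDerivAt {f f' : ℝ → ℝ} {a b : ℝ} (hc : ContinuousOn f (Set.Icc a b))
    (hd : ∀ t, a < t → t < b → HasDerivAt f (f' t) t) (hf' : ∀ t, a < t → t < b → f' t ≤ 0) :
    AntitoneOn f (Set.Icc a b) := by
  refine antitoneOn_of_deriv_nonpos (convex_Icc a b) hc ?_ ?_ <;> rw [interior_Icc]
  · exact fun t ht => (hd t ht.1 ht.2).differentiableAt.differentiableWithinAt
  · exact fun t ht => (hd t ht.1 ht.2).deriv ▸ hf' t ht.1 ht.2

/-- A function satisfying `D' ≤ -δ < 0` on a half line is not bounded below. -/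
theorem exists_lt_of_hasDerivAt_le {D D' : ℝ → ℝ} {a δ : ℝ} (hc : ContinuousOn D (Set.Ici a))
    (hd : ∀ t, a < t → HasDerivAt D (D' t) t) (hδ : 0 < δ) (hD' : ∀ t, a < t → D' t ≤ -δ)
    (B : ℝ) : ∃ t, a ≤ t ∧ D t < B := by
  have hanti := antitoneOn_Ici_of_hasDerivAt (f := fun t => D t + δ * t)
    (f' := fun t => D' t + δ * 1) (hc.add (by fun_prop))
    (fun t ht => (hd t ht).add ((hasDerivAt_id t).const_mul δ))
    (fun t ht => by linarith [hD' t ht])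
  -- By this time `D` has dropped by at least `|D a - B| + 1`.
  refine ⟨a + (|D a - B| + 1) / δ, le_add_of_nonneg_right (by positivity), ?_⟩
  have h := hanti (Set.mem_Ici.2 le_rfl)
    (Set.mem_Ici.2 (le_add_of_nonneg_right (by positivity : 0 ≤ (|D a - B| + 1) / δ)))
    (le_add_of_nonneg_right (by positivity))
  simp only [mul_add, mul_div_cancel₀ _ hδ.ne'] at h
  linarith [le_abs_self (D a - B)]

/-- Grönwall's inequality on `[0, ∞)` with a variable rate. -/
theorem le_mul_exp_neg_integral {D D' a : ℝ → ℝ} (hc : ContinuousOn D (Set.Ici 0))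
    (hd : ∀ t, 0 < t → HasDerivAt D (D' t) t) (ha : ContinuousOn a (Set.Ici 0))
    (hD' : ∀ t, 0 < t → D' t ≤ -(a t * D t)) {t : ℝ} (ht : 0 ≤ t) :
    D t ≤ D 0 * Real.exp (-∫ s in (0 : ℝ)..t, a s) := by
  have hb : Continuous fun s => a (max s 0) :=
    ha.comp_continuous (by fun_prop) fun s => Set.mem_Ici.2 (le_max_right _ _)
  have hΦ : ∀ s, HasDerivAt (fun s => ∫ r in (0 : ℝ)..s, a (max r 0)) (a (max s 0)) s := fun s =>
    intervalIntegral.integral_hasDerivAt_right (hb.intervalIntegrable _ _)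
      (hb.stronglyMeasurableAtFilter _ _) hb.continuousAt
  have hΦc : Continuous fun s => ∫ r in (0 : ℝ)..s, a (max r 0) :=
    continuous_iff_continuousAt.2 fun s => (hΦ s).continuousAt
  -- The product of `D` with the integrating factor `exp(∫a)` is antitone.
  have hanti := antitoneOn_Ici_of_hasDerivAt (hc.mul (Real.continuous_exp.comp hΦc).continuousOn)
    (fun s hs => (hd s hs).mul (hΦ s).exp) (fun s hs => by
      have h := hD' s hs
      rw [max_eq_left hs.le]
      have he := Real.exp_pos (∫ r in (0 : ℝ)..s, a (max r 0))
      simp only [Function.comp_apply]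
      nlinarith)
  have h := hanti (Set.mem_Ici.2 le_rfl) (Set.mem_Ici.2 ht) ht
  have hcongr : ∫ s in (0 : ℝ)..t, a (max s 0) = ∫ s in (0 : ℝ)..t, a s :=
    intervalIntegral.integral_congr fun s hs => by
      rw [Set.uIcc_of_le ht] at hs
      simp only [max_eq_left hs.1]
  simp only [Pi.mul_apply, Function.comp_apply, intervalIntegral.integral_same, Real.exp_zero,
    mul_one, hcongr] at h
  rwa [Real.exp_neg, ← div_eq_mul_inv, le_div_iff₀ (Real.exp_pos _)]

/-- If `2 A A' = D` while `A > 0`, with `D` antitone, then `A` stays positive. -/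
theorem pos_of_two_mul_mul_deriv_eq {A g D : ℝ → ℝ} (hAc : ContinuousOn A (Set.Ici 0))
    (hA : ∀ t, 0 < t → HasDerivAt A (g t) t) (hDc : ContinuousOn D (Set.Ici 0))
    (hD : AntitoneOn D (Set.Ici 0)) (h0 : 0 < A 0)
    (hg : ∀ t, 0 < t → 0 < A t → 2 * A t * g t = D t) {t : ℝ} (ht : 0 ≤ t) : 0 < A t := by
  by_contra! hneg
  -- `t1` is the first zero of `A`; the relation between `g` and `D` is available only before it.
  obtain ⟨t1, ⟨⟨ht1, htt⟩, hz⟩, hmin⟩ : ∃ t1, IsLeast (Set.Icc 0 t ∩ A ⁻¹' {0}) t1 := by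
    refine IsCompact.exists_isLeast ?_ ?_
    · have hclosed := (hAc.mono Set.Icc_subset_Ici_self).preimage_isClosed_of_isClosed
        (isClosed_Icc (a := 0) (b := t)) (isClosed_singleton (x := (0 : ℝ)))
      exact isCompact_Icc.of_isClosed_subset hclosed Set.inter_subset_left
    · obtain ⟨s, hs, hs'⟩ := intermediate_value_Icc' ht (hAc.mono Set.Icc_subset_Ici_self)
        ⟨hneg, h0.le⟩
      exact ⟨s, hs, hs'⟩
  have hz : A t1 = 0 := hz
  have ht1' : 0 < t1 := lt_of_le_of_ne ht1 fun h => by rw [← h] at hz; linarith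
  have hpos : ∀ s, 0 ≤ s → s < t1 → 0 < A s := fun s hs hst => by
    by_contra! hle
    obtain ⟨r, hr, hr'⟩ := intermediate_value_Icc' hs (hAc.mono Set.Icc_subset_Ici_self)
      ⟨hle, h0.le⟩
    linarith [hmin ⟨⟨hr.1, by linarith [hr.2]⟩, hr'⟩, hr.2]
  -- If `D t1 ≥ 0`, then `D ≥ 0` before `t1`, so `A` is nondecreasing there and cannot reach zero.
  rcases le_or_gt 0 (D t1) with hD1 | hD1
  · have hanti := antitoneOn_Icc_of_hasDerivAt (a := 0) (b := t1)
      (hAc.mono Set.Icc_subset_Ici_self).neg (fun s hs _ => (hA s hs).neg) (fun s hs hst => by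
        have h1 := hpos s hs.le hst
        have h2 := hg s hs h1
        have h3 : D t1 ≤ D s := hD (Set.mem_Ici.2 hs.le) (Set.mem_Ici.2 ht1) hst.le
        by_contra! hlt
        nlinarith)
    have := hanti ⟨le_rfl, ht1⟩ ⟨ht1, le_rfl⟩ ht1
    simp only [Pi.neg_apply, hz] at this
    linarith
  -- If `D t1 < 0`, then `(A²)' = D < D t1 / 2` just before `t1`, so `A² - (D t1 / 2)s` is antitone
  -- up to `t1`. But `A` is differentiable at its zero `t1`, so `A²` has derivative `0` there and
  -- this function has the positive derivative `-D t1 / 2`.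
  · have hev : ∀ᶠ s in nhds t1, D s < D t1 / 2 :=
      (hDc.continuousAt (Ici_mem_nhds ht1')).eventually (gt_mem_nhds (by linarith))
    obtain ⟨ε, hε, hball⟩ := Metric.eventually_nhds_iff.1 hev
    set s0 := max (t1 / 2) (t1 - ε / 2) with hs0
    have hs0lt : s0 < t1 := max_lt (by linarith) (by linarith)
    have hs0pos : 0 < s0 := lt_of_lt_of_le (by linarith) (le_max_left _ _)
    have hs0ε : t1 - ε / 2 ≤ s0 := le_max_right _ _
    have hder : ∀ s, 0 < s → HasDerivAt (fun s => A s ^ 2 + -(D t1 / 2) * s)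
        (2 * A s * g s + -(D t1 / 2)) s := fun s hs => by
      refine (((hA s hs).pow 2).add ((hasDerivAt_id s).const_mul (-(D t1 / 2)))).congr_deriv ?_
      simp
    have hanti := antitoneOn_Icc_of_hasDerivAt (a := s0) (b := t1)
      (fun s hs => (hder s (by linarith [hs.1])).continuousAt.continuousWithinAt)
      (fun s hs _ => hder s (by linarith)) (fun s hs hst => by
        have hs' : 0 < s := by linarith
        rw [hg s hs' (hpos s hs'.le hst)]
        have := hball (y := s) (by rw [Real.dist_eq, abs_lt]; constructor <;> linarith)
        linarith)
    have hle := hanti.derivWithin_nonpos (x := t1)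
    rw [(hder t1 ht1').hasDerivWithinAt.derivWithin
      ((uniqueDiffOn_Icc hs0lt) t1 ⟨hs0lt.le, le_rfl⟩), hz] at hle
    linarith

/-! ### The isoperimetric gap along the flow -/

namespace CurveFlow

/-- The quantity `L² - 4 π n A`, for a real number `n`. -/
noncomputable def isoperimetricGap (n : ℝ) (c : ℝ → ℂ) : ℝ :=
  length c ^ 2 - 4 * Real.pi * n * area c

namespace IsGlobalClassicalSolution

variable {F : FlowKind} {γ : ℝ → ℝ → ℂ} (hγ : IsGlobalClassicalSolution F γ) {n : ℕ}
  (hrot : rotationNumber (γ 0) = n)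
include hγ

theorem length_pos {t : ℝ} (ht : 0 ≤ t) : 0 < CurveFlow.length (γ t) :=
  (hγ.isClosedImmersed ht).length_pos

theorem continuousOn_isoperimetricGap (n : ℝ) :
    ContinuousOn (fun t => isoperimetricGap n (γ t)) (Set.Ici 0) :=
  (hγ.continuousOn_length.pow 2).sub (continuousOn_const.mul hγ.continuousOn_area)

include hrot

theorem totalCurvature_eq {t : ℝ} (ht : 0 ≤ t) : totalCurvature (γ t) = 2 * Real.pi * n := by
  have hpi := Real.pi_pos
  rw [hγ.totalCurvature_eq_initial ht, ← hrot, rotationNumber]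
  field_simp

theorem deficit_eq {t : ℝ} (ht : 0 ≤ t) :
    deficit (γ t) = isoperimetricGap n (γ t) / CurveFlow.length (γ t) ^ 2 := by
  have hpi := Real.pi_pos
  have hL := hγ.length_pos ht
  rw [deficit, rotationNumber, hγ.totalCurvature_eq hrot ht, isoperimetricGap]
  field_simp

/-- The non-local term contributes `4πn g` both to `(L²)'` and to `4πnA'`, and cancels. -/
theorem hasDerivAt_isoperimetricGap {t : ℝ} (ht : 0 < t) :
    HasDerivAt (fun t => isoperimetricGap n (γ t))
      (-(2 * CurveFlow.length (γ t) *
        arcIntegral (γ t) (fun u => curvatureDeviation (γ t) u ^ 2))) t := by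
  have hL := hγ.length_pos ht.le
  refine (((hγ.hasDerivAt_length ht).pow 2).sub
    ((hγ.hasDerivAt_area ht).const_mul (4 * Real.pi * n))).congr_deriv ?_
  rw [hγ.totalCurvature_eq hrot ht.le]
  field_simp
  ring

theorem antitoneOn_isoperimetricGap :
    AntitoneOn (fun t => isoperimetricGap n (γ t)) (Set.Ici 0) :=
  antitoneOn_Ici_of_hasDerivAt (hγ.continuousOn_isoperimetricGap n)
    (fun _ ht => hγ.hasDerivAt_isoperimetricGap hrot ht) fun _ ht => neg_nonpos.2 <|
      mul_nonneg (mul_nonneg zero_le_two (hγ.length_pos ht.le).le)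
        IsClosedImmersed.arcIntegral_curvatureDeviation_sq_nonneg

/-- If `d m ≤ m²` for all eigenvalues `m = k (k - n)`, the gap decays at the rate `8 π² d / L²`. -/
theorem deriv_isoperimetricGap_le {t : ℝ} (ht : 0 ≤ t) (d : ℝ)
    (hd : ∀ k : ℤ, d * (k * (k - (n : ℤ)) : ℝ) ≤ (k * (k - (n : ℤ)) : ℝ) ^ 2) :
    -(2 * CurveFlow.length (γ t) *
        arcIntegral (γ t) (fun u => curvatureDeviation (γ t) u ^ 2)) ≤
      -(8 * Real.pi ^ 2 * d / CurveFlow.length (γ t) ^ 2 * isoperimetricGap n (γ t)) := by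
  have hL := hγ.length_pos ht
  have h := (hγ.isClosedImmersed ht).mul_le_arcIntegral_curvatureDeviation_sq (N := n)
    (by simpa using hγ.totalCurvature_eq hrot ht) d (by simpa using hd)
  rw [Int.cast_natCast] at h
  change 4 * Real.pi ^ 2 * d * isoperimetricGap n (γ t) ≤ _ at h
  rw [neg_le_neg_iff, div_mul_eq_mul_div, div_le_iff₀ (by positivity)]
  linarith

/-- The choice `d = n` is admissible: `k(k - n) ≤ 0` for `0 ≤ k ≤ n`, and `k(k - n) ≥ n` for all
other integers. -/
theorem deriv_isoperimetricGap_le_neg_mul {t : ℝ} (ht : 0 ≤ t) :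
    -(2 * CurveFlow.length (γ t) *
        arcIntegral (γ t) (fun u => curvatureDeviation (γ t) u ^ 2)) ≤
      -(8 * Real.pi ^ 2 * n / CurveFlow.length (γ t) ^ 2 * isoperimetricGap n (γ t)) := by
  refine hγ.deriv_isoperimetricGap_le hrot ht n fun k => ?_
  have : (n : ℤ) * (k * (k - n)) ≤ (k * (k - n)) ^ 2 := by
    rcases le_or_gt k 0 with h | h
    · have h1 : 0 ≤ k * (k - n) := by nlinarith
      rcases eq_or_lt_of_le h with rfl | h'
      · simp
      · have : (n : ℤ) ≤ k * (k - n) := by nlinarith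
        nlinarith
    · rcases le_or_gt k n with h' | h'
      · have h1 : k * (k - n) ≤ 0 := by nlinarith
        nlinarith [sq_nonneg (k * (k - n))]
      · have : (n : ℤ) ≤ k * (k - n) := by nlinarith
        nlinarith
  exact_mod_cast this

/-- The choice `d = -1` is admissible because `-m ≤ m²` for integers. It is informative when the gap
is negative, where a positive `d` gives nothing. -/
theorem deriv_isoperimetricGap_le_mul {t : ℝ} (ht : 0 ≤ t) :
    -(2 * CurveFlow.length (γ t) *
        arcIntegral (γ t) (fun u => curvatureDeviation (γ t) u ^ 2)) ≤
      8 * Real.pi ^ 2 / CurveFlow.length (γ t) ^ 2 * isoperimetricGap n (γ t) := by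
  refine (hγ.deriv_isoperimetricGap_le hrot ht (-1) fun k => ?_).trans (le_of_eq (by ring))
  have : ∀ m : ℤ, -1 * m ≤ m ^ 2 := fun m => by
    rcases le_or_gt 0 m with h | h <;> nlinarith
  exact_mod_cast this (k * (k - n))

theorem isoperimetricGap_le_mul_exp {t : ℝ} (ht : 0 ≤ t) :
    isoperimetricGap n (γ t) ≤ isoperimetricGap n (γ 0) *
      Real.exp (-∫ τ in (0 : ℝ)..t, 8 * Real.pi ^ 2 * n / CurveFlow.length (γ τ) ^ 2) :=
  le_mul_exp_neg_integral (hγ.continuousOn_isoperimetricGap n)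
    (fun _ ht => hγ.hasDerivAt_isoperimetricGap hrot ht)
    (continuousOn_const.div (hγ.continuousOn_length.pow 2) fun _ ht =>
      pow_ne_zero 2 (hγ.length_pos ht).ne')
    (fun _ ht => hγ.deriv_isoperimetricGap_le_neg_mul hrot ht.le) ht

/-- A negative gap is impossible if afterwards the length is bounded and the gap bounded below. -/
theorem isoperimetricGap_nonneg_of_bounded {t : ℝ} (ht : 0 ≤ t) {M B : ℝ}
    (hM : ∀ s, t ≤ s → isoperimetricGap n (γ s) < 0 → CurveFlow.length (γ s) ^ 2 ≤ M)
    (hB : ∀ s, t ≤ s → B ≤ isoperimetricGap n (γ s)) : 0 ≤ isoperimetricGap n (γ t) := by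
  by_contra! hneg
  have hanti := hγ.antitoneOn_isoperimetricGap hrot
  have hle : ∀ s, t ≤ s → isoperimetricGap n (γ s) ≤ isoperimetricGap n (γ t) := fun s hs =>
    hanti (Set.mem_Ici.2 ht) (Set.mem_Ici.2 (ht.trans hs)) hs
  have hM0 : 0 < M := (pow_pos (hγ.length_pos ht) 2).trans_le (hM t le_rfl hneg)
  -- The gap is antitone, so after `t` it stays below its negative value at `t`; together with `L² ≤
  -- M` this gives a uniform rate of decrease.
  obtain ⟨s, hs, hsB⟩ := exists_lt_of_hasDerivAt_le
    (δ := 8 * Real.pi ^ 2 / M * -isoperimetricGap n (γ t))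
    ((hγ.continuousOn_isoperimetricGap n).mono (Set.Ici_subset_Ici.2 ht))
    (fun s hs => hγ.hasDerivAt_isoperimetricGap hrot (ht.trans_lt hs))
    (mul_pos (div_pos (by positivity) hM0) (neg_pos.2 hneg)) (fun s hs => by
      have hs0 : 0 ≤ s := ht.trans (le_of_lt hs)
      have h1 := hle s hs.le
      refine (hγ.deriv_isoperimetricGap_le_mul hrot hs0).trans ?_
      have h2 : 8 * Real.pi ^ 2 / M ≤ 8 * Real.pi ^ 2 / CurveFlow.length (γ s) ^ 2 :=
        div_le_div_of_nonneg_left (by positivity) (pow_pos (hγ.length_pos hs0) 2)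
          (hM s hs.le (h1.trans_lt hneg))
      have h3 : 0 ≤ 8 * Real.pi ^ 2 / M := by positivity
      have h4 := mul_le_mul h2 (neg_le_neg h1) (neg_nonneg.2 hneg.le) (h3.trans h2)
      linarith) B
  exact absurd hsB (not_lt.2 (hB s hs))

end IsGlobalClassicalSolution

/-! ### Sign of the gap and length bounds for each flow -/

namespace IsGlobalClassicalSolution

variable {γ : ℝ → ℝ → ℂ} {n : ℕ}

theorem area_eq_of_AP (hγ : IsGlobalClassicalSolution .AP γ) {t : ℝ} (ht : 0 ≤ t) :
    area (γ t) = area (γ 0) := by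
  have h : ∀ s, 0 < s → HasDerivAt (fun t => area (γ t)) 0 s := fun s hs => hγ.hasDerivAt_area hs
  have h1 := antitoneOn_Ici_of_hasDerivAt hγ.continuousOn_area h (fun _ _ => le_rfl)
    (Set.mem_Ici.2 le_rfl) (Set.mem_Ici.2 ht) ht
  have h2 := antitoneOn_Ici_of_hasDerivAt hγ.continuousOn_area.neg (fun s hs => (h s hs).neg)
    (fun _ _ => neg_zero.le) (Set.mem_Ici.2 le_rfl) (Set.mem_Ici.2 ht) ht
  exact le_antisymm h1 (neg_le_neg_iff.1 h2)

theorem length_le_of_AP (hγ : IsGlobalClassicalSolution .AP γ) {t : ℝ} (ht : 0 ≤ t) :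
    CurveFlow.length (γ t) ≤ CurveFlow.length (γ 0) :=
  antitoneOn_Ici_of_hasDerivAt hγ.continuousOn_length (fun s hs => hγ.hasDerivAt_length hs)
    (fun s _ => by
      simpa [nonlocalTerm] using
        IsClosedImmersed.arcIntegral_curvatureDeviation_sq_nonneg (c := γ s))
    (Set.mem_Ici.2 le_rfl) (Set.mem_Ici.2 ht) ht

/-- With `A` constant, a negative gap itself says `L² < 4πnA(0)`, and `L² ≥ 0` bounds the gap below.
-/
theorem isoperimetricGap_nonneg_of_AP (hγ : IsGlobalClassicalSolution .AP γ)
    (hrot : rotationNumber (γ 0) = n) {t : ℝ} (ht : 0 ≤ t) : 0 ≤ isoperimetricGap n (γ t) := by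
  refine hγ.isoperimetricGap_nonneg_of_bounded hrot ht (M := 4 * Real.pi * n * area (γ 0))
    (B := -(4 * Real.pi * n * area (γ 0))) (fun s hs h => ?_) fun s hs => ?_
  · rw [isoperimetricGap, hγ.area_eq_of_AP (ht.trans hs)] at h
    linarith
  · rw [isoperimetricGap, hγ.area_eq_of_AP (ht.trans hs)]
    linarith [sq_nonneg (CurveFlow.length (γ s))]

theorem length_eq_of_LP (hγ : IsGlobalClassicalSolution .LP γ) (hn : 1 ≤ n)
    (hrot : rotationNumber (γ 0) = n) {t : ℝ} (ht : 0 ≤ t) :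
    CurveFlow.length (γ t) = CurveFlow.length (γ 0) := by
  have h : ∀ s, 0 < s → HasDerivAt (fun t => CurveFlow.length (γ t)) 0 s := fun s hs => by
    refine (hγ.hasDerivAt_length hs).congr_deriv ?_
    have hL := hγ.length_pos hs.le
    have hT : totalCurvature (γ s) ≠ 0 := by
      rw [hγ.totalCurvature_eq hrot hs.le]
      have : (0 : ℝ) < n := by exact_mod_cast hn
      positivity
    rw [nonlocalTerm]
    field_simp
    ring
  have h1 := antitoneOn_Ici_of_hasDerivAt hγ.continuousOn_length h (fun _ _ => le_rfl)
    (Set.mem_Ici.2 le_rfl) (Set.mem_Ici.2 ht) ht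
  have h2 := antitoneOn_Ici_of_hasDerivAt hγ.continuousOn_length.neg (fun s hs => (h s hs).neg)
    (fun _ _ => neg_zero.le) (Set.mem_Ici.2 le_rfl) (Set.mem_Ici.2 ht) ht
  exact le_antisymm h1 (neg_le_neg_iff.1 h2)

/-- Here `L` is constant, and the classical isoperimetric inequality bounds `A` above, hence the gap
below. -/
theorem isoperimetricGap_nonneg_of_LP (hγ : IsGlobalClassicalSolution .LP γ) (hn : 1 ≤ n)
    (hrot : rotationNumber (γ 0) = n) {t : ℝ} (ht : 0 ≤ t) : 0 ≤ isoperimetricGap n (γ t) := by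
  refine hγ.isoperimetricGap_nonneg_of_bounded hrot ht (M := CurveFlow.length (γ 0) ^ 2)
    (B := CurveFlow.length (γ 0) ^ 2 - n * CurveFlow.length (γ 0) ^ 2)
    (fun s hs _ => ?_) fun s hs => ?_
  · rw [hγ.length_eq_of_LP hn hrot (ht.trans hs)]
  · have h := (hγ.isClosedImmersed (ht.trans hs)).isoperimetric
    rw [isoperimetricGap, ← hγ.length_eq_of_LP hn hrot (ht.trans hs)]
    have := mul_le_mul_of_nonneg_left h n.cast_nonneg
    linarith

theorem two_mul_area_mul_nonlocalTerm_of_JP (hγ : IsGlobalClassicalSolution .JP γ)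
    (hrot : rotationNumber (γ 0) = n) {t : ℝ} (ht : 0 ≤ t) (hA : 0 < area (γ t)) :
    2 * area (γ t) * nonlocalTerm .JP (γ t) = isoperimetricGap n (γ t) := by
  rw [nonlocalTerm, isoperimetricGap, hγ.totalCurvature_eq hrot ht]
  field_simp
  ring

theorem area_pos_of_JP (hγ : IsGlobalClassicalSolution .JP γ) (hrot : rotationNumber (γ 0) = n)
    (hA : 0 < area (γ 0)) {t : ℝ} (ht : 0 ≤ t) : 0 < area (γ t) :=
  pos_of_two_mul_mul_deriv_eq hγ.continuousOn_area (fun _ hs => hγ.hasDerivAt_area hs)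
    (hγ.continuousOn_isoperimetricGap n) (hγ.antitoneOn_isoperimetricGap hrot) hA
    (fun _ hs h => hγ.two_mul_area_mul_nonlocalTerm_of_JP hrot hs.le h) ht

/-- Since `(A²)'` equals the antitone gap, a negative value would drive `A²` below zero. No length
bound is needed. -/
theorem isoperimetricGap_nonneg_of_JP (hγ : IsGlobalClassicalSolution .JP γ)
    (hrot : rotationNumber (γ 0) = n) (hA : 0 < area (γ 0)) {t : ℝ} (ht : 0 ≤ t) :
    0 ≤ isoperimetricGap n (γ t) := by
  by_contra! hneg
  obtain ⟨s, -, hs⟩ := exists_lt_of_hasDerivAt_le (D := fun t => area (γ t) ^ 2)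
    (D' := fun t => isoperimetricGap n (γ t)) (δ := -isoperimetricGap n (γ t))
    ((hγ.continuousOn_area.pow 2).mono (Set.Ici_subset_Ici.2 ht))
    (fun s hs => by
      have hs0 : 0 < s := ht.trans_lt hs
      refine ((hγ.hasDerivAt_area hs0).pow 2).congr_deriv ?_
      rw [← hγ.two_mul_area_mul_nonlocalTerm_of_JP hrot hs0.le (hγ.area_pos_of_JP hrot hA hs0.le)]
      simp)
    (neg_pos.2 hneg)
    (fun s hs => by
      rw [neg_neg]
      exact hγ.antitoneOn_isoperimetricGap hrot (Set.mem_Ici.2 ht)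
        (Set.mem_Ici.2 (ht.trans (le_of_lt hs))) (le_of_lt hs)) 0
  exact absurd hs (not_lt.2 (sq_nonneg _))

theorem nonlocalTerm_nonneg_of_JP (hγ : IsGlobalClassicalSolution .JP γ)
    (hrot : rotationNumber (γ 0) = n) (hA : 0 < area (γ 0)) {t : ℝ} (ht : 0 ≤ t) :
    0 ≤ nonlocalTerm .JP (γ t) := by
  have h1 := hγ.area_pos_of_JP hrot hA ht
  have h2 := hγ.isoperimetricGap_nonneg_of_JP hrot hA ht
  rw [← hγ.two_mul_area_mul_nonlocalTerm_of_JP hrot ht h1] at h2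
  exact nonneg_of_mul_nonneg_right h2 (by positivity)

theorem area_le_of_JP (hγ : IsGlobalClassicalSolution .JP γ)
    (hrot : rotationNumber (γ 0) = n) (hA : 0 < area (γ 0)) {t : ℝ} (ht : 0 ≤ t) :
    area (γ 0) ≤ area (γ t) :=
  neg_le_neg_iff.1 <| antitoneOn_Ici_of_hasDerivAt hγ.continuousOn_area.neg
    (fun _ hs => (hγ.hasDerivAt_area hs).neg)
    (fun _ hs => neg_nonpos.2 (hγ.nonlocalTerm_nonneg_of_JP hrot hA hs.le))
    (Set.mem_Ici.2 le_rfl) (Set.mem_Ici.2 ht) ht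

/-- Since `A` is nondecreasing and `D ≤ D0`, one has `L² ≤ C A`. Then `D' ≤ -(8π²n/L²)·2A A' ≤ -k
A'` with `k = 16π²n/C`, so `D + kA` is antitone. As `D ≥ 0`, this bounds `A`, and with it `L`. -/
theorem bddAbove_length_of_JP (hγ : IsGlobalClassicalSolution .JP γ) (hn : 1 ≤ n)
    (hrot : rotationNumber (γ 0) = n) (hA : 0 < area (γ 0)) :
    BddAbove ((fun t => CurveFlow.length (γ t)) '' Set.Ici 0) := by
  have hn' : (0 : ℝ) < n := by exact_mod_cast hn
  set D0 := isoperimetricGap n (γ 0) with hD0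
  have hD0' : 0 ≤ D0 := hγ.isoperimetricGap_nonneg_of_JP hrot hA le_rfl
  set C : ℝ := D0 / area (γ 0) + 4 * Real.pi * n with hC
  have hC' : 0 < C := by positivity
  have hgap : ∀ t, 0 ≤ t → isoperimetricGap n (γ t) ≤ D0 := fun t ht =>
    hγ.antitoneOn_isoperimetricGap hrot (Set.mem_Ici.2 le_rfl) (Set.mem_Ici.2 ht) ht
  have hLA : ∀ t, 0 ≤ t → CurveFlow.length (γ t) ^ 2 ≤ C * area (γ t) := fun t ht => by
    have h1 := hgap t ht
    have h2 : D0 ≤ D0 / area (γ 0) * area (γ t) := by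
      rw [div_mul_eq_mul_div, le_div_iff₀ hA]
      exact mul_le_mul_of_nonneg_left (hγ.area_le_of_JP hrot hA ht) hD0'
    rw [isoperimetricGap] at h1
    rw [hC, add_mul]
    linarith
  set k : ℝ := 16 * Real.pi ^ 2 * n / C with hk
  have hk' : 0 < k := by positivity
  have hanti := antitoneOn_Ici_of_hasDerivAt
    ((hγ.continuousOn_isoperimetricGap n).add (continuousOn_const (c := k) |>.mul
      hγ.continuousOn_area))
    (fun t ht => (hγ.hasDerivAt_isoperimetricGap hrot ht).add
      ((hγ.hasDerivAt_area ht).const_mul k)) (fun t ht => by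
        have hL := hγ.length_pos ht.le
        have hAt := hγ.area_pos_of_JP hrot hA ht.le
        have hg := hγ.nonlocalTerm_nonneg_of_JP hrot hA ht.le
        have h1 := hγ.deriv_isoperimetricGap_le_neg_mul hrot ht.le
        rw [← hγ.two_mul_area_mul_nonlocalTerm_of_JP hrot ht.le hAt] at h1
        have h2 : k * nonlocalTerm .JP (γ t) ≤ 8 * Real.pi ^ 2 * n / CurveFlow.length (γ t) ^ 2 *
            (2 * area (γ t) * nonlocalTerm .JP (γ t)) := by
          rw [hk, div_mul_eq_mul_div, div_mul_eq_mul_div,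
            div_le_div_iff₀ hC' (by positivity)]
          have := mul_le_mul_of_nonneg_left (hLA t ht.le)
            (by positivity : 0 ≤ 16 * Real.pi ^ 2 * n * nonlocalTerm .JP (γ t))
          linarith
        linarith)
  refine ⟨Real.sqrt (C * ((D0 + k * area (γ 0)) / k)), ?_⟩
  rintro _ ⟨t, ht, rfl⟩
  have h := hanti (Set.mem_Ici.2 le_rfl) ht ht
  have h0 := hγ.isoperimetricGap_nonneg_of_JP hrot hA ht
  simp only [Pi.add_apply, Pi.mul_apply, ← hD0] at h
  refine Real.le_sqrt_of_sq_le ((hLA t ht).trans (mul_le_mul_of_nonneg_left ?_ hC'.le))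
  rw [le_div_iff₀ hk']
  linarith

end IsGlobalClassicalSolution

/-! ### Decay of the deficit -/

theorem IsGlobalClassicalSolution.isoperimetricGap_nonneg {F : FlowKind} {γ : ℝ → ℝ → ℂ} {n : ℕ}
    (hγ : IsGlobalClassicalSolution F γ) (hn : 1 ≤ n) (hrot : rotationNumber (γ 0) = n)
    (hA : 0 < area (γ 0)) {t : ℝ} (ht : 0 ≤ t) : 0 ≤ isoperimetricGap n (γ t) := by
  cases F with
  | AP => exact hγ.isoperimetricGap_nonneg_of_AP hrot ht
  | LP => exact hγ.isoperimetricGap_nonneg_of_LP hn hrot ht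
  | JP => exact hγ.isoperimetricGap_nonneg_of_JP hrot hA ht

/-- The decay estimate with an upper bound `M` for the length and a lower bound `Q` for the
square of the length at time `t`. -/
theorem IsGlobalClassicalSolution.deficit_le {F : FlowKind} {γ : ℝ → ℝ → ℂ} {n : ℕ}
    (hγ : IsGlobalClassicalSolution F γ) (hn : 1 ≤ n) (hrot : rotationNumber (γ 0) = n)
    (hA : 0 < area (γ 0)) {t M Q : ℝ} (ht : 0 ≤ t)
    (hM : ∀ s, 0 ≤ s → CurveFlow.length (γ s) ≤ M) (hQ : 0 < Q)
    (hQ' : Q ≤ CurveFlow.length (γ t) ^ 2) :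
    deficit (γ t) ≤ CurveFlow.length (γ 0) ^ 2 * deficit (γ 0) / Q *
      Real.exp (-(8 * Real.pi ^ 2 * n / M ^ 2) * t) := by
  have hL0 := hγ.length_pos le_rfl
  have hg0 := hγ.isoperimetricGap_nonneg hn hrot hA le_rfl
  have hg := hγ.isoperimetricGap_nonneg hn hrot hA ht
  have hcont : ContinuousOn (fun s => 8 * Real.pi ^ 2 * n / CurveFlow.length (γ s) ^ 2)
      (Set.Ici 0) := continuousOn_const.div (hγ.continuousOn_length.pow 2) fun _ ht =>
    pow_ne_zero 2 (hγ.length_pos ht).ne'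
  have hint : 8 * Real.pi ^ 2 * n / M ^ 2 * t ≤
      ∫ s in (0 : ℝ)..t, 8 * Real.pi ^ 2 * n / CurveFlow.length (γ s) ^ 2 := by
    have h := intervalIntegral.integral_mono_on ht
      (intervalIntegrable_const (μ := MeasureTheory.volume) (c := 8 * Real.pi ^ 2 * n / M ^ 2))
      (ContinuousOn.intervalIntegrable (by
        rw [Set.uIcc_of_le ht]; exact hcont.mono Set.Icc_subset_Ici_self)) fun s hs => by
          have hLs := hγ.length_pos hs.1
          exact div_le_div_of_nonneg_left (by positivity) (by positivity)
            (pow_le_pow_left₀ hLs.le (hM s hs.1) 2)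
    rw [intervalIntegral.integral_const, smul_eq_mul] at h
    linarith
  rw [hγ.deficit_eq hrot ht, hγ.deficit_eq hrot le_rfl, mul_div_cancel₀ _ (by positivity)]
  calc isoperimetricGap n (γ t) / CurveFlow.length (γ t) ^ 2
      ≤ isoperimetricGap n (γ t) / Q := div_le_div_of_nonneg_left hg hQ hQ'
    _ ≤ isoperimetricGap n (γ 0) * Real.exp (-(8 * Real.pi ^ 2 * n / M ^ 2) * t) / Q := by
        refine div_le_div_of_nonneg_right ?_ hQ.le
        refine (hγ.isoperimetricGap_le_mul_exp hrot ht).trans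
          (mul_le_mul_of_nonneg_left (Real.exp_le_exp.2 ?_) hg0)
        linarith
    _ = _ := by ring

end CurveFlow

theorem mainTheorem12 (F : FlowKind) (γ : ℝ → ℝ → ℂ) (n : ℕ) (hn : 1 ≤ n)
    (hγ : IsGlobalClassicalSolution F γ)
    (hrot : rotationNumber (γ 0) = n)
    (hA : 0 < area (γ 0)) :
    (∀ t : ℝ, 0 ≤ t →
      0 ≤ deficit (γ t) ∧
      deficit (γ t) ≤
        CurveFlow.length (γ 0) ^ 2 * deficit (γ 0) / CurveFlow.length (γ t) ^ 2 *
          Real.exp (-∫ τ in (0 : ℝ)..t, 8 * Real.pi ^ 2 * n / CurveFlow.length (γ τ) ^ 2)) ∧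
    (F = FlowKind.AP → ∀ t : ℝ, 0 ≤ t →
      0 ≤ deficit (γ t) ∧
      deficit (γ t) ≤
        CurveFlow.length (γ 0) ^ 2 * deficit (γ 0) / (4 * Real.pi * n * area (γ 0)) *
          Real.exp (-(8 * Real.pi ^ 2 * n / CurveFlow.length (γ 0) ^ 2) * t)) ∧
    (F = FlowKind.LP → ∀ t : ℝ, 0 ≤ t →
      0 ≤ deficit (γ t) ∧
      deficit (γ t) ≤
        deficit (γ 0) *
          Real.exp (-(8 * Real.pi ^ 2 * n / CurveFlow.length (γ 0) ^ 2) * t)) ∧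
    (F = FlowKind.JP →
      BddAbove ((fun t => CurveFlow.length (γ t)) '' Set.Ici 0) ∧
      ∀ t : ℝ, 0 ≤ t →
        0 ≤ deficit (γ t) ∧
        deficit (γ t) ≤
          CurveFlow.length (γ 0) ^ 2 * deficit (γ 0) / (4 * Real.pi * n * area (γ 0)) *
            Real.exp (-(8 * Real.pi ^ 2 * n /
              sSup ((fun s => CurveFlow.length (γ s)) '' Set.Ici 0) ^ 2) * t)) := by
  have hn' : (0 : ℝ) < n := by exact_mod_cast hn
  have hpi := Real.pi_pos
  have hgap : ∀ t, 0 ≤ t → 0 ≤ isoperimetricGap n (γ t) := fun t ht =>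
    hγ.isoperimetricGap_nonneg hn hrot hA ht
  have hL : ∀ t, 0 ≤ t → 0 < CurveFlow.length (γ t) := fun t ht => hγ.length_pos ht
  have hnonneg : ∀ t, 0 ≤ t → 0 ≤ deficit (γ t) := fun t ht => by
    rw [hγ.deficit_eq hrot ht]
    exact div_nonneg (hgap t ht) (sq_nonneg _)
  -- Nonnegativity of the gap gives `L² ≥ 4πnA`, the source of the denominator `4πnA(0)` when the
  -- area does not fall below its initial value.
  have hQ : ∀ t, 0 ≤ t → area (γ 0) ≤ area (γ t) →
      4 * Real.pi * n * area (γ 0) ≤ CurveFlow.length (γ t) ^ 2 := fun t ht h => by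
    have h1 := hgap t ht
    have h2 := mul_le_mul_of_nonneg_left h (by positivity : 0 ≤ 4 * Real.pi * n)
    rw [isoperimetricGap] at h1
    linarith
  refine ⟨fun t ht => ⟨hnonneg t ht, ?_⟩, ?_, ?_, ?_⟩
  · have h0 := hL 0 le_rfl
    rw [hγ.deficit_eq hrot ht, hγ.deficit_eq hrot le_rfl, mul_div_cancel₀ _ (by positivity),
      div_mul_eq_mul_div]
    exact div_le_div_of_nonneg_right (hγ.isoperimetricGap_le_mul_exp hrot ht) (sq_nonneg _)
  · rintro rfl t ht
    exact ⟨hnonneg t ht, hγ.deficit_le hn hrot hA ht (fun s hs => hγ.length_le_of_AP hs)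
      (by positivity) (hQ t ht (hγ.area_eq_of_AP ht).ge)⟩
  · rintro rfl t ht
    have h0 := hL 0 le_rfl
    have h := hγ.deficit_le hn hrot hA ht (fun s hs => (hγ.length_eq_of_LP hn hrot hs).le)
      (pow_pos h0 2) (by rw [hγ.length_eq_of_LP hn hrot ht])
    rw [mul_div_cancel_left₀ _ (by positivity)] at h
    exact ⟨hnonneg t ht, h⟩
  · rintro rfl
    have hB := hγ.bddAbove_length_of_JP hn hrot hA
    exact ⟨hB, fun t ht => ⟨hnonneg t ht, hγ.deficit_le hn hrot hA ht
      (fun s hs => le_csSup hB ⟨s, hs, rfl⟩) (by positivity)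
      (hQ t ht (hγ.area_le_of_JP hrot hA ht))⟩⟩
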